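/- Let $l\ge 1$, let $k_1,\dots,k_l\ge 0$ be integers, put $k=1+\sum_i k_i$, and let $r_1,\dots,r_l>0$ satisfy $\sum_i r_i^2=1$. Let $$\Sigma=S^{k_1}(r_1)\times\cdots\times S^{k_l}(r_l)\subset\mathbb{R}^n=\mathbb{R}^{k_1+1}\times\cdots\times\mathbb{R}^{k_l+1},$$ where $S^{k_i}(r_i)\subset\mathbb{R}^{k_i+1}$ is the sphere of radius $r_i$ centred at $0$, let $C(\Sigma)=\{tx : t\ge 0,\ x\in\Sigma\}$ be the ($k$-dimensional) cone over $\Sigma$, and let $M=C(\Sigma)\setminus\{0\}$. Assume that the cone is minimal, that is, the mean curvature vector of $M$ vanishes. Let $\alpha\in\mathbb{R}$ and $f(x)=|x|^\alpha$. If $\alpha\ge -k+2\sqrt{2(k-1)}$, then $C(\Sigma)$ is $f$-stable. In particular, $C(\Sigma)$ is $f$-stable if $k\ge 7$ and $\alpha\ge 4\sqrt3-7$. Here $f$-stable means the following. Put $U=\mathbb{R}^n\setminus\{0\}$. The set $M$ is an embedded $k$-dimensional $C^2$ submanifold, closed relative to $U$. It is $f$-stationary in $U$: $$\int_M \big(f\,\operatorname{div}X+\langle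 Df,X\rangle\big)\,d\mathcal H_k=0$$ for every $C^1$ vector field $X$ with compact support in $U$, where $\operatorname{div}X=\sum_{i=1}^k\langle D_{e_i}X,e_i\rangle$. Finally, $$\int_M f\Big[\sum_{i,j=1}^k\langle \mathbf B(e_i,e_j),X\rangle^2+\langle\mathbf H,X\rangle^2\Big]d\mathcal H_k\ \le\ \int_M \Big( f\sum_{i=1}^k\big|(D_{e_i}X)^\perp\big|^2+\operatorname{Hess}f(X,X)\Big)\,d\mathcal H_k$$ for every $C^1$ vector field $X$ with compact support in $U$ that is normal to $M$ along $M$. All these integrals are absolutely convergent. Here $e_1,\dots,e_k$ is an orthonormal basis of the tangent space of $M$ at the point considered, $\mathbf B(u,v)=(D_uV)^\perp$ (with $V$ a tangent field extending $v$) is the second fundamental form of $M$ in $\mathbb{R}^n$, $\mathbf H=\sum_i\mathbf B(e_i,e_i)$, and $^\perp$ is the projection to the normal space of $M$. -/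

import Mathlib

open MeasureTheory

open scoped InnerProductSpace

noncomputable section

namespace WeightedArea

section Submanifold

variable {E : Type*} [NormedAddCommGroup E] [InnerProductSpace ℝ E] [FiniteDimensional ℝ E]

/-- `M` is an embedded `k`-dimensional submanifold of class `C²` of the Euclidean space `E`:
locally it is the zero set of a `C²` submersion onto a space of dimension `dim E - k`. -/
def IsC2Submanifold (k : ℕ) (M : Set E) : Prop :=
  ∃ c : ℕ, k + c = Module.finrank ℝ E ∧
    ∀ x ∈ M, ∃ V : Set E, IsOpen V ∧ x ∈ V ∧
      ∃ F : E → EuclideanSpace ℝ (Fin c), ContDiffOn ℝ 2 F V ∧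
        (∀ y ∈ V, Function.Surjective (fderiv ℝ F y)) ∧
        ∀ y ∈ V, y ∈ M ↔ F y = 0

/-- The tangent space `T_x M`, the span of the tangent cone of `M` at `x` (for a `C¹` submanifold
the tangent cone already is the tangent space). -/
def tangentSpace (M : Set E) (x : E) : Submodule ℝ E :=
  Submodule.span ℝ (tangentConeAt ℝ M x)

/-- The orthogonal projection `v ↦ vᵀ` of `E` onto `T_x M`. -/
def tangential (M : Set E) (x : E) : E →L[ℝ] E :=
  (tangentSpace M x).starProjection

/-- The orthogonal projection `v ↦ v^⊥` of `E` onto the normal space `(T_x M)ᗮ`. -/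
def normal (M : Set E) (x : E) : E →L[ℝ] E :=
  (tangentSpace M x)ᗮ.starProjection

/-- An orthonormal basis `e_1, …, e_k` of `T_x M`. Every expression in which it is used below
is independent of its choice. -/
def tangentFrame (M : Set E) (x : E) :
    OrthonormalBasis (Fin (Module.finrank ℝ (tangentSpace M x))) ℝ (tangentSpace M x) :=
  stdOrthonormalBasis ℝ (tangentSpace M x)

/-- The second fundamental form `B(u, v) = (D_u Y)^⊥` of `M` at `x`, for `u, v ∈ T_x M`, where `Y`
is a tangent vector field on `M` with `Y x = v`; here `Y y = vᵀ`, the projection of the constant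
field `v` to `T_y M`. The derivative is taken along `M`. -/
def secondFundamentalForm (M : Set E) (x u v : E) : E :=
  normal M x (fderivWithin ℝ (fun y => tangential M y v) M x u)

/-- The mean curvature vector `H = ∑ i, B(e_i, e_i)`. -/
def meanCurvature (M : Set E) (x : E) : E :=
  ∑ i, secondFundamentalForm M x (tangentFrame M x i) (tangentFrame M x i)

/-- `M` is minimal: its mean curvature vector vanishes. -/
def IsMinimal (M : Set E) : Prop :=
  ∀ x ∈ M, meanCurvature M x = 0

/-- The divergence `div X = ∑ i, ⟨D_{e_i} X, e_i⟩` of the vector field `X` on `M`. -/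
def divergence (M : Set E) (X : E → E) (x : E) : ℝ :=
  ∑ i, ⟪fderiv ℝ X x (tangentFrame M x i), (tangentFrame M x i : E)⟫_ℝ

/-- The integrand `f div X + ⟨Df, X⟩` of the first variation of `∫_M f dH_k`. -/
def firstVariationIntegrand (f : E → ℝ) (M : Set E) (X : E → E) (x : E) : ℝ :=
  f x * divergence M X x + fderiv ℝ f x (X x)

/-- `f (∑ i j, ⟨B(e_i, e_j), X⟩² + ⟨H, X⟩²)`. -/
def curvatureIntegrand (f : E → ℝ) (M : Set E) (X : E → E) (x : E) : ℝ :=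
  f x * ((∑ i, ∑ j,
    ⟪secondFundamentalForm M x (tangentFrame M x i) (tangentFrame M x j), X x⟫_ℝ ^ 2)
      + ⟪meanCurvature M x, X x⟫_ℝ ^ 2)

/-- `f ∑ i, |(D_{e_i} X)^⊥|² + Hess f (X, X)`. -/
def gradientIntegrand (f : E → ℝ) (M : Set E) (X : E → E) (x : E) : ℝ :=
  f x * (∑ i, ‖normal M x (fderiv ℝ X x (tangentFrame M x i))‖ ^ 2)
    + fderiv ℝ (fderiv ℝ f) x (X x) (X x)

/-- A `C¹` vector field with compact support in `U`. If `U` is open and `M` is a submanifold that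
is closed relative to `U`, the restrictions of these to `M` are exactly the `C¹` fields along `M`
with compact support in `M ∩ U`. -/
structure IsVariationField (U : Set E) (X : E → E) : Prop where
  contDiff : ContDiff ℝ 1 X
  hasCompactSupport : HasCompactSupport X
  tsupport_subset : tsupport X ⊆ U

variable [MeasurableSpace E] [BorelSpace E]

/-- `M` is `f`-stationary in `U`: the first variation of `∫_M f dH_k` vanishes for all variation
fields with compact support in `U`. Here `μHE[k]` is the `k`-dimensional Hausdorff measure with
its Euclidean normalization. -/
def IsStationary (k : ℕ) (f : E → ℝ) (M U : Set E) : Prop :=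
  ∀ X : E → E, IsVariationField U X →
    IntegrableOn (firstVariationIntegrand f M X) M μHE[k] ∧
      ∫ x in M, firstVariationIntegrand f M X x ∂μHE[k] = 0

/-- The `k`-dimensional `C²` submanifold `M` is `f`-stable in the open set `U`: it has no boundary
points in `U`, it is `f`-stationary in `U`, and it satisfies the stability inequality for all normal
variation fields with compact support in `U`. -/
structure IsStable (k : ℕ) (f : E → ℝ) (M U : Set E) : Prop where
  isOpen : IsOpen U
  nonempty : (U ∩ M).Nonempty
  closed_in : U ∩ (closure M \ M) = ∅
  density : ContDiffOn ℝ 2 f U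
  submanifold : IsC2Submanifold k M
  stationary : IsStationary k f M U
  stability : ∀ X : E → E, IsVariationField U X → (∀ x ∈ M, X x ∈ (tangentSpace M x)ᗮ) →
    IntegrableOn (curvatureIntegrand f M X) M μHE[k] ∧
      IntegrableOn (gradientIntegrand f M X) M μHE[k] ∧
      ∫ x in M, curvatureIntegrand f M X x ∂μHE[k]
        ≤ ∫ x in M, gradientIntegrand f M X x ∂μHE[k]

end Submanifold

/-- The cone `C(S) = {t x | t ≥ 0, x ∈ S}` over `S`. -/
def cone {E : Type*} [AddCommGroup E] [Module ℝ E] (S : Set E) : Set E :=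
  {y | ∃ t : ℝ, 0 ≤ t ∧ ∃ x ∈ S, y = t • x}

/-- The Euclidean space `ℝ^{d_1 + 1} × ⋯ × ℝ^{d_l + 1}`. -/
abbrev BlockSpace {l : ℕ} (d : Fin l → ℕ) : Type :=
  PiLp 2 (fun i : Fin l => EuclideanSpace ℝ (Fin (d i + 1)))

/-- The product `S^{d_1}(r_1) × ⋯ × S^{d_l}(r_l)` of round spheres centred at the origin. -/
def sphereProduct {l : ℕ} (d : Fin l → ℕ) (r : Fin l → ℝ) : Set (BlockSpace d) :=
  {x | ∀ i, ‖x i‖ = r i}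

end WeightedArea

end

/-! The radial field `x` and the rotations of the single blocks are tangent to the cone and generate
isometries or dilations that preserve it. At each point they form a weighted frame of the tangent
space (`frame_expansion`), so every trace over `e_i` becomes an explicit sum (`sum_tangentFrame`).
The normal vectors are the `(c_i x_i)` with `∑ c_i r_i² = 0`, and in such a direction the second
fundamental form is `-⟨c u, v⟩`. Hence minimality forces `d_i = (k - 1) r_i²`
(`dim_eq_of_isMinimal`), and then `∑ ⟨B(e_i, e_j), X⟩² = (k - 1) |X|² / |x|²` for every normal `X`.

The Hessian of `|x|^α` on normal vectors gives `α |x|^(α-2) |X|²`, so stability reduces to a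
weighted Hardy inequality with constant `((α + k - 2) / 2)²` for the radial derivative of `X`; the
rotational derivatives are dropped. The hypothesis on `α` says exactly that `α + k` lies at or above
the larger root of `((α + k - 2) / 2)² + α - (k - 1)`.

Integration by parts comes from symmetry of Hausdorff measure: differentiating the invariance under
rotations and the scaling under dilations gives `∫ D_{Rx} φ = 0` and `∫ D_x φ = -k ∫ φ`
(`integral_fderiv_flow`). These two identities yield both stationarity and the Hardy inequality. -/

noncomputable section

namespace WeightedArea

/-! ### Infinitesimal rotations of a Euclidean space -/

section Rotation

variable {n : ℕ}

/-- The infinitesimal rotation `v ↦ v_a e_b - v_b e_a`. -/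
def coordRotation (a b : Fin n) : EuclideanSpace ℝ (Fin n) →L[ℝ] EuclideanSpace ℝ (Fin n) :=
  (EuclideanSpace.proj a : EuclideanSpace ℝ (Fin n) →L[ℝ] ℝ).smulRight
      (EuclideanSpace.single b (1 : ℝ))
    - (EuclideanSpace.proj b : EuclideanSpace ℝ (Fin n) →L[ℝ] ℝ).smulRight
      (EuclideanSpace.single a (1 : ℝ))

theorem coordRotation_apply (a b : Fin n) (v : EuclideanSpace ℝ (Fin n)) :
    coordRotation a b v
      = v a • EuclideanSpace.single b (1 : ℝ) - v b • EuclideanSpace.single a (1 : ℝ) := rfl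

theorem inner_coordRotation (a b : Fin n) (u v : EuclideanSpace ℝ (Fin n)) :
    ⟪coordRotation a b u, v⟫_ℝ = u a * v b - u b * v a := by
  simp [coordRotation_apply, inner_sub_left, inner_smul_left, EuclideanSpace.inner_single_left]

theorem coordRotation_skew (a b : Fin n) (u v : EuclideanSpace ℝ (Fin n)) :
    ⟪coordRotation a b u, v⟫_ℝ = -⟪u, coordRotation a b v⟫_ℝ := by
  rw [real_inner_comm _ u, inner_coordRotation, inner_coordRotation]; ring

theorem inner_eq_sum_mul (u v : EuclideanSpace ℝ (Fin n)) : ⟪v, u⟫_ℝ = ∑ a, v a * u a := by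
  rw [PiLp.inner_apply]
  exact Finset.sum_congr rfl fun a _ => by simp [mul_comm]

theorem coordRotation_coord (a b c : Fin n) (v : EuclideanSpace ℝ (Fin n)) :
    coordRotation a b v c = (if c = b then v a else 0) - (if c = a then v b else 0) := by
  simp [coordRotation_apply, PiLp.single_apply]

theorem sum_sum_ite_eq_left (c : Fin n) (g : Fin n → Fin n → ℝ) :
    ∑ a, ∑ b, (if c = a then g a b else 0) = ∑ b, g c b := by
  rw [Finset.sum_comm]; simp

/-- The rotation fields at `v` form a tight frame of the tangent space of the sphere through `v`:
the right side is a multiple of the projection to `v^⊥`. The factor 2 arises because ordered pairs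
count each coordinate plane twice. -/
theorem sum_inner_coordRotation_smul (u v : EuclideanSpace ℝ (Fin n)) :
    ∑ a, ∑ b, ⟪coordRotation a b v, u⟫_ℝ • coordRotation a b v
      = (2 : ℝ) • (‖v‖ ^ 2 • u - ⟪v, u⟫_ℝ • v) := by
  ext c
  rw [← real_inner_self_eq_norm_sq, inner_eq_sum_mul, inner_eq_sum_mul]
  simp only [inner_coordRotation, WithLp.ofLp_sum, Finset.sum_apply, PiLp.smul_apply,
    PiLp.sub_apply, coordRotation_coord, smul_eq_mul, mul_sub, mul_ite, mul_zero,
    Finset.sum_sub_distrib, Finset.sum_ite_eq, Finset.mem_univ, if_true, sum_sum_ite_eq_left,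
    Finset.sum_mul, Finset.mul_sum]
  simp only [← Finset.sum_sub_distrib]
  exact Finset.sum_congr rfl fun a _ => by ring

/-- The sum of squares of all rotations is the Casimir operator, a scalar on vectors. It brings the
sphere dimension `n - 1` into the first variation. -/
theorem sum_coordRotation_coordRotation (v : EuclideanSpace ℝ (Fin n)) :
    ∑ a, ∑ b, coordRotation a b (coordRotation a b v) = (-2 * ((n : ℝ) - 1)) • v := by
  ext c
  have h (a b : Fin n) : coordRotation a b (coordRotation a b v) c
      = (if c = b then (if a = b then v a else 0) - v b else 0)
        - (if c = a then v a - (if b = a then v b else 0) else 0) := by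
    rw [coordRotation_coord, coordRotation_coord, coordRotation_coord]; simp
  simp only [WithLp.ofLp_sum, Finset.sum_apply, h, Finset.sum_sub_distrib, sum_sum_ite_eq_left,
    Finset.sum_ite_eq, Finset.sum_ite_eq', Finset.mem_univ, if_true, PiLp.smul_apply, smul_eq_mul,
    Finset.sum_const, Finset.card_univ, Fintype.card_fin, nsmul_eq_mul]
  ring

theorem sum_norm_sq_coordRotation (v : EuclideanSpace ℝ (Fin n)) :
    ∑ a, ∑ b, ‖coordRotation a b v‖ ^ 2 = 2 * ((n : ℝ) - 1) * ‖v‖ ^ 2 := by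
  have h := congrArg (fun w => ⟪v, w⟫_ℝ) (sum_coordRotation_coordRotation v)
  simp only [inner_sum, inner_smul_right, real_inner_self_eq_norm_sq] at h
  rw [show 2 * ((n : ℝ) - 1) * ‖v‖ ^ 2 = -(-2 * ((n : ℝ) - 1) * ‖v‖ ^ 2) by ring, ← h]
  simp only [← Finset.sum_neg_distrib, ← coordRotation_skew, real_inner_self_eq_norm_sq]

end Rotation

/-! ### Flows of skew operators -/

section Flow

variable {V : Type*} [NormedAddCommGroup V] [InnerProductSpace ℝ V] [CompleteSpace V]

/-- A skew operator generates a one-parameter group of isometries. -/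
theorem exists_isometry_flow (S : V →L[ℝ] V) (hS : ∀ u v, ⟪S u, v⟫_ℝ = -⟪u, S v⟫_ℝ) :
    ∃ T : ℝ → V ≃ₗᵢ[ℝ] V, (∀ v, T 0 v = v) ∧
      ∀ t v, HasDerivAt (fun s => T s v) (S (T t v)) t := by
  -- Skewness in the sense of the star algebra makes `exp (t S)` unitary.
  have hskew : S ∈ skewAdjoint (V →L[ℝ] V) := by
    rw [skewAdjoint.mem_iff, ContinuousLinearMap.star_eq_adjoint]
    refine ContinuousLinearMap.ext fun v => ext_inner_right ℝ fun u => ?_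
    rw [ContinuousLinearMap.adjoint_inner_left, neg_apply, inner_neg_left,
      hS, neg_neg]
  have hmem : ∀ t : ℝ, NormedSpace.exp (t • S) ∈ unitary (V →L[ℝ] V) := fun t => by
    let _ : NormedAlgebra ℚ (V →L[ℝ] V) := NormedAlgebra.restrictScalars ℚ ℝ _
    exact NormedSpace.exp_mem_unitary_of_mem_skewAdjoint (skewAdjoint.smul_mem t hskew)
  have hcoe (u : unitary (V →L[ℝ] V)) (v : V) :
      Unitary.linearIsometryEquiv u v = (u : V →L[ℝ] V) v := rfl
  refine ⟨fun t => Unitary.linearIsometryEquiv ⟨_, hmem t⟩, fun v => ?_, fun t v => ?_⟩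
  · rw [hcoe]; simp [NormedSpace.exp_zero]
  · have := (hasDerivAt_exp_smul_const' (𝕂 := ℝ) S t)
    exact (this.clm_apply (hasDerivAt_const t v)).congr_deriv
      (by simp [hcoe])

end Flow

/-! ### Block-diagonal operators -/

section Block

variable {l : ℕ} {d : Fin l → ℕ}

/-- The block-diagonal operator with blocks `S j`. -/
def blockDiag (S : ∀ j, EuclideanSpace ℝ (Fin (d j + 1)) →L[ℝ] EuclideanSpace ℝ (Fin (d j + 1))) :
    BlockSpace d →L[ℝ] BlockSpace d :=
  LinearMap.toContinuousLinearMap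
    { toFun := fun x => WithLp.toLp 2 fun j => S j (x j)
      map_add' := fun x y => by ext; simp
      map_smul' := fun c x => by ext; simp }

@[simp]
theorem blockDiag_apply
    (S : ∀ j, EuclideanSpace ℝ (Fin (d j + 1)) →L[ℝ] EuclideanSpace ℝ (Fin (d j + 1)))
    (x : BlockSpace d) (j : Fin l) : blockDiag S x j = S j (x j) := rfl

/-- The infinitesimal rotation `x_a e_b - x_b e_a` in the `i`-th block. -/
def blockRotation (i : Fin l) (a b : Fin (d i + 1)) : BlockSpace d →L[ℝ] BlockSpace d :=
  blockDiag (Pi.single i (coordRotation a b))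

theorem blockRotation_apply (i : Fin l) (a b : Fin (d i + 1)) (x : BlockSpace d) :
    blockRotation i a b x = PiLp.single 2 i (coordRotation a b (x i)) := by
  ext j : 1
  by_cases h : j = i
  · subst h; simp [blockRotation]
  · simp [blockRotation, h]

theorem inner_single_block (i : Fin l) (v : EuclideanSpace ℝ (Fin (d i + 1))) (y : BlockSpace d) :
    ⟪(PiLp.single 2 i v : BlockSpace d), y⟫_ℝ = ⟪v, y i⟫_ℝ := by
  rw [PiLp.inner_apply, Finset.sum_eq_single i]
  · simp
  · intro j _ hj; simp [hj]
  · simp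

theorem inner_blockRotation (i : Fin l) (a b : Fin (d i + 1)) (x y : BlockSpace d) :
    ⟪blockRotation i a b x, y⟫_ℝ = ⟪coordRotation a b (x i), y i⟫_ℝ := by
  rw [blockRotation_apply, inner_single_block]

theorem blockRotation_skew (i : Fin l) (a b : Fin (d i + 1)) (x y : BlockSpace d) :
    ⟪blockRotation i a b x, y⟫_ℝ = -⟪x, blockRotation i a b y⟫_ℝ := by
  rw [real_inner_comm _ x, inner_blockRotation, inner_blockRotation, coordRotation_skew,
    real_inner_comm]

theorem inner_blockRotation_self (i : Fin l) (a b : Fin (d i + 1)) (x : BlockSpace d) :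
    ⟪x, blockRotation i a b x⟫_ℝ = 0 := by
  have := blockRotation_skew i a b x x
  rw [real_inner_comm] at this
  linarith

/-- The rotation `x_a e_b - x_b e_a` of a block generates a one-parameter group of isometries
that preserve the norms of all blocks. -/
theorem exists_blockRotation_flow (i : Fin l) (a b : Fin (d i + 1)) :
    ∃ T : ℝ → BlockSpace d ≃ₗᵢ[ℝ] BlockSpace d, (∀ x, T 0 x = x) ∧
      (∀ t x, HasDerivAt (fun s => T s x) (blockRotation i a b (T t x)) t) ∧
      ∀ t x j, ‖T t x j‖ = ‖x j‖ := by
  have hS : ∀ j, ∀ u v, ⟪(Pi.single i (coordRotation a b) :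
      ∀ j, EuclideanSpace ℝ (Fin (d j + 1)) →L[ℝ] EuclideanSpace ℝ (Fin (d j + 1))) j u, v⟫_ℝ
      = -⟪u, (Pi.single i (coordRotation a b) :
      ∀ j, EuclideanSpace ℝ (Fin (d j + 1)) →L[ℝ] EuclideanSpace ℝ (Fin (d j + 1))) j v⟫_ℝ := by
    intro j u v
    by_cases h : j = i
    · subst h; simpa using coordRotation_skew a b u v
    · simp [h]
  choose T hT0 hT using fun j => exists_isometry_flow _ (hS j)
  refine ⟨fun t => LinearIsometryEquiv.piLpCongrRight 2 fun j => T j t, fun x => ?_,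
    fun t x => ?_, fun t x j => ?_⟩
  · ext j : 1; simp [hT0]
  · rw [hasDerivAt_iff_hasFDerivAt, ← hasFDerivWithinAt_univ, hasFDerivWithinAt_piLp]
    intro j
    rw [hasFDerivWithinAt_univ]
    exact (hT j t (x j)).hasFDerivAt.congr_fderiv (by ext; simp [blockRotation])
  · simp

end Block

section Geometry

/-! ### The cone over a product of spheres and its tangent spaces -/

section LinearAlgebra

variable {E : Type*} [NormedAddCommGroup E] [InnerProductSpace ℝ E]

/-- The trace of a bilinear form over a subspace may be computed in any frame. -/
theorem sum_orthonormalBasis_eq_sum_frame {ι n : Type*} [Fintype ι] [Fintype n]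
    {T : Submodule ℝ E} (b : OrthonormalBasis n ℝ T) {w : ι → E} (hw : ∀ m, w m ∈ T) {a : ι → ℝ}
    (h : ∀ u ∈ T, ∑ m, (a m * ⟪w m, u⟫_ℝ) • w m = u) (B : E →ₗ[ℝ] E →ₗ[ℝ] ℝ) :
    ∑ i, B (b i) (b i) = ∑ m, a m * B (w m) (w m) := by
  -- One copy of `b i` is expanded in the frame `w`; the sum over `i` then reassembles `w m` in the
  -- other slot.
  calc ∑ i, B (b i) (b i) = ∑ i, ∑ m, a m * ⟪w m, b i⟫_ℝ * B (w m) (b i) := by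
        refine Finset.sum_congr rfl fun i _ => ?_
        conv_lhs => enter [1, 2]; rw [← h _ (b i).2]
        simp
    _ = ∑ m, a m * B (w m) (∑ i, ⟪w m, b i⟫_ℝ • (b i : E)) := by
        rw [Finset.sum_comm]
        refine Finset.sum_congr rfl fun m _ => ?_
        simp only [map_sum, map_smul, smul_eq_mul, Finset.mul_sum]
        exact Finset.sum_congr rfl fun i _ => by ring
    _ = ∑ m, a m * B (w m) (w m) := by
        refine Finset.sum_congr rfl fun m _ => ?_
        congr 2
        have := congrArg (Subtype.val) (b.sum_repr' ⟨w m, hw m⟩)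
        simp only [Submodule.coe_sum, Submodule.coe_smul, Submodule.coe_inner] at this
        conv_rhs => rw [← this]
        exact Finset.sum_congr rfl fun i _ => by rw [real_inner_comm]

end LinearAlgebra

/-- The cone over a product of spheres, without its vertex. -/
abbrev sphereCone {l : ℕ} (d : Fin l → ℕ) (r : Fin l → ℝ) : Set (BlockSpace d) :=
  cone (sphereProduct d r) \ {0}

variable {l : ℕ} {d : Fin l → ℕ} {r : Fin l → ℝ}

/-- The block-diagonal operator that multiplies the `j`-th block by `c j`. -/
def blockScale (c : Fin l → ℝ) : BlockSpace d →L[ℝ] BlockSpace d :=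
  blockDiag fun j => c j • ContinuousLinearMap.id ℝ _

@[simp]
theorem blockScale_apply (c : Fin l → ℝ) (x : BlockSpace d) (j : Fin l) :
    blockScale c x j = c j • x j := rfl

/-- Points of the product have norm 1 because `∑ r_i² = 1`, so normalizing a point of the cone lands
in the product. The resulting homogeneous equations replace the definition from here on. -/
theorem mem_sphereCone (hr1 : ∑ i, r i ^ 2 = 1) {x : BlockSpace d} :
    x ∈ sphereCone d r ↔ x ≠ 0 ∧ ∀ i, ‖x i‖ = r i * ‖x‖ := by
  constructor
  · rintro ⟨⟨t, ht, y, hy, rfl⟩, hx⟩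
    refine ⟨hx, fun i => ?_⟩
    have hy1 : ‖y‖ = 1 := by
      have := PiLp.norm_sq_eq_of_L2 _ y
      rw [Finset.sum_congr rfl fun i _ => by rw [hy i], hr1] at this
      nlinarith [norm_nonneg y]
    rw [PiLp.smul_apply, norm_smul, norm_smul, hy1, hy i]
    ring
  · rintro ⟨hx, h⟩
    have hn : ‖x‖ ≠ 0 := norm_ne_zero_iff.2 hx
    refine ⟨⟨‖x‖, norm_nonneg _, ‖x‖⁻¹ • x, fun i => ?_, by rw [smul_inv_smul₀ hn]⟩, hx⟩
    rw [PiLp.smul_apply, norm_smul, h i, norm_inv, norm_norm]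
    field_simp

section

variable (hr : ∀ i, 0 < r i) (hr1 : ∑ i, r i ^ 2 = 1) {x : BlockSpace d}

include hr1

theorem norm_pos_of_mem (hx : x ∈ sphereCone d r) : 0 < ‖x‖ :=
  norm_pos_iff.2 ((mem_sphereCone hr1).1 hx).1

theorem norm_block_sq (hx : x ∈ sphereCone d r) (i : Fin l) :
    ‖x i‖ ^ 2 = r i ^ 2 * ‖x‖ ^ 2 := by
  rw [((mem_sphereCone hr1).1 hx).2 i]; ring

theorem smul_mem_sphereCone (hx : x ∈ sphereCone d r) {t : ℝ} (ht : 0 < t) :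
    t • x ∈ sphereCone d r := by
  rw [mem_sphereCone hr1] at hx ⊢
  refine ⟨smul_ne_zero ht.ne' hx.1, fun i => ?_⟩
  rw [PiLp.smul_apply, norm_smul, norm_smul, hx.2 i]
  ring

theorem mem_sphereCone_of_norm_block (hx : x ∈ sphereCone d r) {y : BlockSpace d}
    (h : ∀ j, ‖y j‖ = ‖x j‖) : y ∈ sphereCone d r := by
  have hn : ‖y‖ = ‖x‖ := by
    rw [← sq_eq_sq₀ (norm_nonneg _) (norm_nonneg _), PiLp.norm_sq_eq_of_L2, PiLp.norm_sq_eq_of_L2]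
    simp only [h]
  rw [mem_sphereCone hr1] at hx ⊢
  refine ⟨?_, fun i => by rw [h, hn, hx.2]⟩
  rw [← norm_ne_zero_iff, hn]
  exact norm_ne_zero_iff.2 hx.1

theorem self_mem_tangentSpace (hx : x ∈ sphereCone d r) :
    x ∈ tangentSpace (sphereCone d r) x := by
  refine Submodule.subset_span ?_
  -- The segment from `x` to `2 x` stays in the cone, so its direction `x` is tangent.
  have : (2 : ℝ) • x - x ∈ tangentConeAt ℝ (sphereCone d r) x := by
    refine mem_tangentConeAt_of_segment_subset fun y hy => ?_
    rw [segment_eq_image'] at hy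
    obtain ⟨t, ht, rfl⟩ := hy
    convert smul_mem_sphereCone hr1 hx (t := 1 + t) (by linarith [ht.1]) using 1
    module
  convert this using 1
  module

theorem blockRotation_mem_tangentSpace (hx : x ∈ sphereCone d r) (i : Fin l)
    (a b : Fin (d i + 1)) : blockRotation i a b x ∈ tangentSpace (sphereCone d r) x := by
  obtain ⟨T, hT0, hT, hTn⟩ := exists_blockRotation_flow i a b
  refine Submodule.subset_span ?_
  have h0 := hT 0 x
  rw [hT0] at h0
  have := h0.hasFDerivAt.hasFDerivWithinAt (s := Set.univ) |>.mapsTo_tangent_cone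
    (show (1 : ℝ) ∈ tangentConeAt ℝ Set.univ 0 by simp)
  rw [hT0] at this
  refine tangentConeAt_mono ?_ (by simpa using this)
  rintro _ ⟨t, -, rfl⟩
  exact mem_sphereCone_of_norm_block hr1 hx (hTn t x)

theorem inner_self_normal (hx : x ∈ sphereCone d r) {N : BlockSpace d}
    (hN : N ∈ (tangentSpace (sphereCone d r) x)ᗮ) : ⟪x, N⟫_ℝ = 0 :=
  (Submodule.mem_orthogonal _ _).1 hN _ (self_mem_tangentSpace hr1 hx)

include hr

/-- The rotations of block `i` reproduce the part of `v i` orthogonal to `x i`, up to the factor `2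
|x_i|² = 2 r_i² |x|²`. The hypothesis says that what remains in each block is the same multiple of
`x i`, hence a multiple of `x`. -/
theorem frame_expansion (hx : x ∈ sphereCone d r) {v : BlockSpace d}
    (hv : ∀ i, ⟪x i, v i⟫_ℝ = r i ^ 2 * ⟪x, v⟫_ℝ) :
    ((‖x‖ ^ 2)⁻¹ * ⟪x, v⟫_ℝ) • x + ∑ i, ∑ a, ∑ b, ((2 * r i ^ 2 * ‖x‖ ^ 2)⁻¹ *
      ⟪blockRotation i a b x, v⟫_ℝ) • blockRotation i a b x = v := by
  have hn := (norm_pos_of_mem hr1 hx).ne'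
  have key (i : Fin l) : ∑ a, ∑ b, ((2 * r i ^ 2 * ‖x‖ ^ 2)⁻¹ *
      ⟪blockRotation i a b x, v⟫_ℝ) • blockRotation i a b x
      = PiLp.single 2 i (v i - ((‖x‖ ^ 2)⁻¹ * ⟪x, v⟫_ℝ) • x i) := by
    have hri := (hr i).ne'
    ext j : 1
    by_cases hj : j = i
    · subst hj
      simp only [mul_smul, ← Finset.smul_sum, inner_single_block, blockRotation_apply,
        WithLp.ofLp_sum, Finset.sum_apply, PiLp.smul_apply, PiLp.single_eq_same]
      rw [sum_inner_coordRotation_smul, norm_block_sq hr1 hx, hv]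
      match_scalars <;> field_simp
    · simp [blockRotation_apply, hj]
  simp only [key]
  ext j : 1
  simp only [PiLp.add_apply, PiLp.smul_apply, WithLp.ofLp_sum, Finset.sum_apply]
  rw [Finset.sum_eq_single j (fun i _ hi => by simp [hi.symm]) (by simp)]
  simp

/-- Differentiating `|y_i|² = r_i² |y|²` along the cone gives necessity; derivatives within a set
are unique on its tangent cone. Sufficiency is `frame_expansion`, whose frame vectors are all
tangent. -/
theorem mem_tangentSpace_iff (hx : x ∈ sphereCone d r) {v : BlockSpace d} :
    v ∈ tangentSpace (sphereCone d r) x ↔ ∀ i, ⟪x i, v i⟫_ℝ = r i ^ 2 * ⟪x, v⟫_ℝ := by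
  constructor
  · intro hv i
    let L : BlockSpace d →L[ℝ] ℝ := (2 • (innerSL ℝ (x i)) ∘L (PiLp.proj 2 _ i))
      - (r i ^ 2) • (2 • innerSL ℝ x)
    have hL : HasFDerivWithinAt (fun y : BlockSpace d => ‖y i‖ ^ 2 - r i ^ 2 * ‖y‖ ^ 2) L
        (sphereCone d r) x := by
      refine HasFDerivAt.hasFDerivWithinAt (HasFDerivAt.sub ?_ ?_)
      · exact (PiLp.hasFDerivAt_apply 2 x i).norm_sq
      · exact ((hasFDerivAt_id x).norm_sq).const_mul _
    have h0 : HasFDerivWithinAt (fun y : BlockSpace d => ‖y i‖ ^ 2 - r i ^ 2 * ‖y‖ ^ 2) 0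
        (sphereCone d r) x :=
      (hasFDerivWithinAt_const (𝕜 := ℝ) (0 : ℝ) x (sphereCone d r)).congr
        (fun y hy => by rw [norm_block_sq hr1 hy]; ring)
        (by rw [norm_block_sq hr1 hx]; ring)
    have hle : tangentSpace (sphereCone d r) x ≤ L.ker :=
      Submodule.span_le.2 fun w hw => by simpa using hL.unique_on h0 hw
    have := hle hv
    simp [L] at this
    linarith
  · intro hv
    rw [← frame_expansion hr hr1 hx hv]
    refine Submodule.add_mem _ (Submodule.smul_mem _ _ (self_mem_tangentSpace hr1 hx)) ?_
    exact Submodule.sum_mem _ fun i _ => Submodule.sum_mem _ fun a _ => Submodule.sum_mem _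
      fun b _ => Submodule.smul_mem _ _ (blockRotation_mem_tangentSpace hr1 hx i a b)

/-- The trace of a bilinear form over a tangent space of the cone, in terms of the radial
direction and of the infinitesimal rotations of the blocks. -/
theorem sum_tangentFrame (hx : x ∈ sphereCone d r)
    (B : BlockSpace d →ₗ[ℝ] BlockSpace d →ₗ[ℝ] ℝ) :
    ∑ i, B (tangentFrame (sphereCone d r) x i) (tangentFrame (sphereCone d r) x i)
      = (‖x‖ ^ 2)⁻¹ * B x x + ∑ i, (2 * r i ^ 2 * ‖x‖ ^ 2)⁻¹ *
        ∑ a, ∑ b, B (blockRotation i a b x) (blockRotation i a b x) := by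
  have := sum_orthonormalBasis_eq_sum_frame (tangentFrame (sphereCone d r) x)
    -- `none` indexes the radial vector, `some` the block rotations.
    (ι := Option (Σ i : Fin l, Fin (d i + 1) × Fin (d i + 1)))
    (w := fun m => m.elim x fun p => blockRotation p.1 p.2.1 p.2.2 x)
    (a := fun m => m.elim (‖x‖ ^ 2)⁻¹ fun p => (2 * r p.1 ^ 2 * ‖x‖ ^ 2)⁻¹) ?_ ?_ B
  · rw [this]
    simp only [Fintype.sum_option, Fintype.sum_sigma, Fintype.sum_prod_type, Option.elim_none,
      Option.elim_some, Finset.mul_sum]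
  · rintro (_ | p)
    · exact self_mem_tangentSpace hr1 hx
    · exact blockRotation_mem_tangentSpace hr1 hx _ _ _
  · intro u hu
    rw [mem_tangentSpace_iff hr hr1 hx] at hu
    simpa only [Fintype.sum_option, Fintype.sum_sigma, Fintype.sum_prod_type, Option.elim_none,
      Option.elim_some] using frame_expansion hr hr1 hx hu

/-- The explicit form of the projection to the tangent spaces. -/
theorem tangential_eq (hx : x ∈ sphereCone d r) (v : BlockSpace d) :
    tangential (sphereCone d r) x v = v + blockScale (fun j =>
      ⟪x, v⟫_ℝ * (‖x‖ ^ 2)⁻¹ - ⟪x j, v j⟫_ℝ * (r j ^ 2 * ‖x‖ ^ 2)⁻¹) x := by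
  have hn := (norm_pos_of_mem hr1 hx).ne'
  have hb (j : Fin l) : ⟪x j, v j + (⟪x, v⟫_ℝ * (‖x‖ ^ 2)⁻¹
      - ⟪x j, v j⟫_ℝ * (r j ^ 2 * ‖x‖ ^ 2)⁻¹) • x j⟫_ℝ = r j ^ 2 * ⟪x, v⟫_ℝ := by
    have hrj := (hr j).ne'
    rw [inner_add_right, inner_smul_right, real_inner_self_eq_norm_sq, norm_block_sq hr1 hx]
    field_simp
    ring
  refine Submodule.eq_starProjection_of_mem_of_inner_eq_zero ?_ fun w hw => ?_
  · rw [mem_tangentSpace_iff hr hr1 hx]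
    intro i
    have : ⟪x, v + blockScale (fun j => ⟪x, v⟫_ℝ * (‖x‖ ^ 2)⁻¹
        - ⟪x j, v j⟫_ℝ * (r j ^ 2 * ‖x‖ ^ 2)⁻¹) x⟫_ℝ = ⟪x, v⟫_ℝ := by
      rw [PiLp.inner_apply]
      simp only [PiLp.add_apply, blockScale_apply, hb]
      rw [← Finset.sum_mul, hr1, one_mul]
    rw [this]
    exact hb i
  · rw [mem_tangentSpace_iff hr hr1 hx] at hw
    rw [PiLp.inner_apply]
    simp only [sub_add_cancel_left, PiLp.neg_apply, blockScale_apply, inner_neg_left,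
      real_inner_smul_left, hw]
    have hsum : ∑ j, ⟪x j, v j⟫_ℝ = ⟪x, v⟫_ℝ := (PiLp.inner_apply x v).symm
    have (j : Fin l) : -((⟪x, v⟫_ℝ * (‖x‖ ^ 2)⁻¹ - ⟪x j, v j⟫_ℝ * (r j ^ 2 * ‖x‖ ^ 2)⁻¹)
        * (r j ^ 2 * ⟪x, w⟫_ℝ)) = (‖x‖ ^ 2)⁻¹ * ⟪x, w⟫_ℝ * (⟪x j, v j⟫_ℝ - r j ^ 2 * ⟪x, v⟫_ℝ) := by
      have hrj := (hr j).ne'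
      field_simp
      ring
    simp only [this]
    rw [← Finset.mul_sum, Finset.sum_sub_distrib, hsum, ← Finset.sum_mul, hr1]
    ring

theorem blockScale_mem_orthogonal (hx : x ∈ sphereCone d r) {c : Fin l → ℝ}
    (hc : ∑ i, c i * r i ^ 2 = 0) :
    blockScale c x ∈ (tangentSpace (sphereCone d r) x)ᗮ := by
  rw [Submodule.mem_orthogonal']
  intro w hw
  rw [mem_tangentSpace_iff hr hr1 hx] at hw
  rw [PiLp.inner_apply]
  simp only [blockScale_apply, real_inner_smul_left, hw, ← mul_assoc]
  rw [← Finset.sum_mul, hc, zero_mul]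

/-- Tangential projection changes a vector only by a block scaling of `x`, so a vector with zero
projection is itself such a scaling. Orthogonality to `x` gives the linear constraint on `c`. -/
theorem exists_eq_blockScale (hx : x ∈ sphereCone d r) {N : BlockSpace d}
    (hN : N ∈ (tangentSpace (sphereCone d r) x)ᗮ) :
    ∃ c : Fin l → ℝ, N = blockScale c x ∧ ∑ i, c i * r i ^ 2 = 0 := by
  have hn := (norm_pos_of_mem hr1 hx).ne'
  have h0 : tangential (sphereCone d r) x N = 0 :=
    (Submodule.starProjection_apply_eq_zero_iff _).2 hN
  rw [tangential_eq hr hr1 hx] at h0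
  have hNe : N = blockScale (fun j =>
      -(⟪x, N⟫_ℝ * (‖x‖ ^ 2)⁻¹ - ⟪x j, N j⟫_ℝ * (r j ^ 2 * ‖x‖ ^ 2)⁻¹)) x := by
    rw [← sub_eq_zero, ← h0]
    ext j : 1
    simp
    module
  refine ⟨_, hNe, ?_⟩
  have : ⟪x, N⟫_ℝ = 0 := (Submodule.mem_orthogonal _ _).1 hN _ (self_mem_tangentSpace hr1 hx)
  rw [hNe, PiLp.inner_apply] at this
  simp only [blockScale_apply, real_inner_smul_right, real_inner_self_eq_norm_sq,
    norm_block_sq hr1 hx, ← mul_assoc] at this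
  rw [← Finset.sum_mul] at this
  simpa [hn] using this

end

end Geometry

section Curvature

/-! ### The curvature of the cone -/

section LinearAlgebra

variable {E : Type*} [NormedAddCommGroup E] [InnerProductSpace ℝ E]

theorem sum_inner_orthonormalBasis_sq {n : Type*} [Fintype n] {T : Submodule ℝ E}
    [T.HasOrthogonalProjection] (b : OrthonormalBasis n ℝ T) (y : E) :
    ∑ j, ⟪y, (b j : E)⟫_ℝ ^ 2 = ‖T.starProjection y‖ ^ 2 := by
  have := b.sum_sq_norm_inner_left (T.orthogonalProjectionOnto y)
  rw [Submodule.starProjection_apply, ← Submodule.coe_norm, ← this]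
  refine Finset.sum_congr rfl fun j _ => ?_
  rw [Submodule.coe_inner, Real.norm_eq_abs, sq_abs, ← Submodule.starProjection_apply,
    Submodule.inner_starProjection_left_eq_right,
    Submodule.starProjection_eq_self_iff.2 (b j).2]

end LinearAlgebra

variable {l : ℕ} {d : Fin l → ℕ} {r : Fin l → ℝ}

theorem blockScale_blockRotation (c : Fin l → ℝ) (i : Fin l) (a b : Fin (d i + 1))
    (x : BlockSpace d) : blockScale c (blockRotation i a b x) = c i • blockRotation i a b x := by
  ext j : 1
  by_cases hj : j = i
  · subst hj; simp
  · simp [blockRotation_apply, hj]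

theorem inner_blockScale_self (c : Fin l → ℝ) (x : BlockSpace d) :
    ⟪blockScale c x, x⟫_ℝ = ∑ i, c i * ‖x i‖ ^ 2 := by
  rw [PiLp.inner_apply]
  simp [real_inner_smul_left]

theorem norm_blockRotation_sq (i : Fin l) (a b : Fin (d i + 1)) (x : BlockSpace d) :
    ‖blockRotation i a b x‖ ^ 2 = ‖coordRotation a b (x i)‖ ^ 2 := by
  rw [blockRotation_apply, PiLp.norm_single]

theorem sum_norm_blockRotation_sq (i : Fin l) (x : BlockSpace d) :
    ∑ a, ∑ b, ‖blockRotation i a b x‖ ^ 2 = 2 * d i * ‖x i‖ ^ 2 := by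
  simp only [norm_blockRotation_sq]
  rw [sum_norm_sq_coordRotation]
  push_cast
  ring

section

variable (hr : ∀ i, 0 < r i) (hr1 : ∑ i, r i ^ 2 = 1) {x : BlockSpace d}

include hr1

theorem sphereCone_nonempty (hr : ∀ i, 0 < r i) : (sphereCone d r).Nonempty := by
  refine ⟨WithLp.toLp 2 fun i => EuclideanSpace.single 0 (r i), ?_⟩
  have hn : ‖(WithLp.toLp 2 fun i => EuclideanSpace.single 0 (r i) : BlockSpace d)‖ = 1 := by
    rw [← sq_eq_sq₀ (norm_nonneg _) zero_le_one, PiLp.norm_sq_eq_of_L2]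
    simpa using hr1
  rw [mem_sphereCone hr1]
  refine ⟨by rw [← norm_ne_zero_iff, hn]; exact one_ne_zero, fun i => ?_⟩
  rw [hn]
  simp [abs_of_pos (hr i)]

theorem norm_blockScale_sq (hx : x ∈ sphereCone d r) (c : Fin l → ℝ) :
    ‖blockScale c x‖ ^ 2 = (∑ i, c i ^ 2 * r i ^ 2) * ‖x‖ ^ 2 := by
  rw [PiLp.norm_sq_eq_of_L2, Finset.sum_mul]
  refine Finset.sum_congr rfl fun i _ => ?_
  rw [blockScale_apply, norm_smul, mul_pow, norm_block_sq hr1 hx, Real.norm_eq_abs, sq_abs]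
  ring

include hr

/-- The explicit projection formula makes sense and is differentiable off the cone. This rules out
the default value 0 of `fderivWithin` in the second fundamental form. -/
theorem differentiableWithinAt_tangential (hx : x ∈ sphereCone d r) (v : BlockSpace d) :
    DifferentiableWithinAt ℝ (fun y => tangential (sphereCone d r) y v) (sphereCone d r) x := by
  have hx0 := (mem_sphereCone hr1).1 hx |>.1
  have hn := (norm_pos_of_mem hr1 hx).ne'
  suffices h : DifferentiableAt ℝ (fun y : BlockSpace d => v + blockScale (fun j =>
      ⟪y, v⟫_ℝ * (‖y‖ ^ 2)⁻¹ - ⟪y j, v j⟫_ℝ * (r j ^ 2 * ‖y‖ ^ 2)⁻¹) y) x from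
    h.differentiableWithinAt.congr (fun y hy => tangential_eq hr hr1 hy v)
      (tangential_eq hr hr1 hx v)
  refine DifferentiableAt.const_add _ ?_
  rw [differentiableAt_piLp]
  intro j
  have hj : DifferentiableAt ℝ (fun y : BlockSpace d => y j) x :=
    (PiLp.hasFDerivAt_apply 2 x j).differentiableAt
  have hrj := (hr j).ne'
  have h1 : DifferentiableAt ℝ (fun y : BlockSpace d => ‖y‖ ^ 2) x := differentiableAt_id.norm_sq ℝ
  suffices hc : DifferentiableAt ℝ (fun y : BlockSpace d =>
      ⟪y, v⟫_ℝ * (‖y‖ ^ 2)⁻¹ - ⟪y j, v j⟫_ℝ * (r j ^ 2 * ‖y‖ ^ 2)⁻¹) x from hc.smul hj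
  refine DifferentiableAt.sub (DifferentiableAt.mul ?_ ?_) (DifferentiableAt.mul ?_ ?_)
  · exact differentiableAt_id.inner ℝ (differentiableAt_const v)
  · exact h1.inv (by positivity)
  · exact hj.inner ℝ (differentiableAt_const (v j))
  · exact (h1.const_mul _).inv (by positivity)

theorem continuousOn_tangential {w : BlockSpace d → BlockSpace d}
    (hw : ContinuousOn w (sphereCone d r)) :
    ContinuousOn (fun y => tangential (sphereCone d r) y (w y)) (sphereCone d r) := by
  suffices h : ContinuousOn (fun y : BlockSpace d => w y + blockScale (fun j =>
      ⟪y, w y⟫_ℝ * (‖y‖ ^ 2)⁻¹ - ⟪y j, w y j⟫_ℝ * (r j ^ 2 * ‖y‖ ^ 2)⁻¹) y) (sphereCone d r) from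
    h.congr fun y hy => tangential_eq hr hr1 hy (w y)
  refine hw.add ((PiLp.continuous_toLp 2 _).comp_continuousOn (continuousOn_pi.2 fun j => ?_))
  have hj : Continuous fun y : BlockSpace d => y j := PiLp.continuous_apply 2 _ j
  have h1 : ContinuousOn (fun y : BlockSpace d => ‖y‖ ^ 2) (sphereCone d r) := by fun_prop
  suffices hc : ContinuousOn (fun y : BlockSpace d => ⟪y, w y⟫_ℝ * (‖y‖ ^ 2)⁻¹
      - ⟪y j, w y j⟫_ℝ * (r j ^ 2 * ‖y‖ ^ 2)⁻¹) (sphereCone d r) from hc.smul hj.continuousOn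
  refine ContinuousOn.sub (ContinuousOn.mul ?_ ?_) (ContinuousOn.mul ?_ ?_)
  · exact continuousOn_id.inner hw
  · exact h1.inv₀ fun y hy => pow_ne_zero 2 (norm_pos_of_mem hr1 hy).ne'
  · exact hj.continuousOn.inner (hj.comp_continuousOn hw)
  · exact (h1.const_mul _).inv₀ fun y hy => mul_ne_zero (pow_ne_zero 2 (hr j).ne')
      (pow_ne_zero 2 (norm_pos_of_mem hr1 hy).ne')

/-- The second fundamental form in the direction of the normal vector `(c_i x_i)`. -/
theorem inner_secondFundamentalForm (hx : x ∈ sphereCone d r) {c : Fin l → ℝ}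
    (hc : ∑ i, c i * r i ^ 2 = 0) {u v : BlockSpace d}
    (hu : u ∈ tangentSpace (sphereCone d r) x) (hv : v ∈ tangentSpace (sphereCone d r) x) :
    ⟪secondFundamentalForm (sphereCone d r) x u v, blockScale c x⟫_ℝ = -⟪blockScale c u, v⟫_ℝ := by
  have hN := blockScale_mem_orthogonal hr hr1 hx hc
  have hL := (differentiableWithinAt_tangential hr hr1 hx v).hasFDerivWithinAt
  set L := fderivWithin ℝ (fun y => tangential (sphereCone d r) y v) (sphereCone d r) x with hLdef
  have h1 : ⟪secondFundamentalForm (sphereCone d r) x u v, blockScale c x⟫_ℝ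
      = ⟪L u, blockScale c x⟫_ℝ := by
    rw [secondFundamentalForm, ← hLdef, normal, Submodule.inner_starProjection_left_eq_right,
      Submodule.starProjection_eq_self_iff.2 hN]
  have h2 := hL.inner ℝ (blockScale c).hasFDerivWithinAt
  -- The field `(c_i y_i)` is normal along the whole cone, so its pairing with a tangent field is
  -- constantly 0. The product rule then moves the derivative onto the linear normal field.
  have h3 : HasFDerivWithinAt
      (fun y : BlockSpace d => ⟪tangential (sphereCone d r) y v, blockScale c y⟫_ℝ)
      (0 : BlockSpace d →L[ℝ] ℝ) (sphereCone d r) x := by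
    have h0 (y : BlockSpace d) (hy : y ∈ sphereCone d r) :
        ⟪tangential (sphereCone d r) y v, blockScale c y⟫_ℝ = 0 :=
      (Submodule.mem_orthogonal _ _).1 (blockScale_mem_orthogonal hr hr1 hy hc) _
        (Submodule.starProjection_apply_mem _ _)
    exact (hasFDerivWithinAt_const (𝕜 := ℝ) (0 : ℝ) x (sphereCone d r)).congr h0 (h0 x hx)
  have h5 : tangential (sphereCone d r) x v = v := Submodule.starProjection_eq_self_iff.2 hv
  have h6 := LinearMap.eqOn_span' (f := ContinuousLinearMap.toLinearMap _)
    (g := ContinuousLinearMap.toLinearMap _) (h2.unique_on h3) hu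
  simp [h5, fderivInnerCLM_apply] at h6
  rw [h1, real_inner_comm v]
  linarith

/-- The radial direction contributes `∑ c_i r_i² = 0`, and the rotations of block `i` contribute
`c_i d_i`. -/
theorem inner_meanCurvature (hx : x ∈ sphereCone d r) {c : Fin l → ℝ}
    (hc : ∑ i, c i * r i ^ 2 = 0) :
    ⟪meanCurvature (sphereCone d r) x, blockScale c x⟫_ℝ = -∑ i, c i * d i := by
  have hn := (norm_pos_of_mem hr1 hx).ne'
  have h := sum_tangentFrame hr hr1 hx ((innerₗ (BlockSpace d)) ∘ₗ (blockScale c).toLinearMap)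
  simp only [LinearMap.comp_apply, ContinuousLinearMap.coe_coe, innerₗ_apply_apply] at h
  rw [meanCurvature, sum_inner]
  simp only [inner_secondFundamentalForm hr hr1 hx hc (SetLike.coe_mem _) (SetLike.coe_mem _),
    Finset.sum_neg_distrib]
  rw [h, inner_blockScale_self]
  simp only [norm_block_sq hr1 hx, blockScale_blockRotation, real_inner_smul_left,
    real_inner_self_eq_norm_sq, ← Finset.mul_sum, sum_norm_blockRotation_sq, ← mul_assoc]
  rw [← Finset.sum_mul, hc, zero_mul, mul_zero, zero_add]
  congr 1
  refine Finset.sum_congr rfl fun i _ => ?_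
  have hri := (hr i).ne'
  field_simp

/-- If the cone is minimal, then the dimensions of the spheres are proportional to the squares of
their radii. -/
theorem dim_eq_of_isMinimal (hmin : IsMinimal (sphereCone d r)) (i : Fin l) :
    (d i : ℝ) = (∑ j, (d j : ℝ)) * r i ^ 2 := by
  obtain ⟨x, hx⟩ := sphereCone_nonempty (d := d) hr1 hr
  -- The `i`-th unit vector, corrected by the constant `r i ^ 2` so that the constraint holds,
  -- isolates `d i`.
  have h := inner_meanCurvature hr hr1 hx (c := fun j => (if j = i then 1 else 0) - r i ^ 2)
    (by simp [sub_mul, Finset.sum_sub_distrib, ← Finset.mul_sum, hr1])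
  rw [hmin x hx, inner_zero_left] at h
  simp only [sub_mul, ite_mul, one_mul, zero_mul, Finset.sum_sub_distrib, Finset.sum_ite_eq',
    Finset.mem_univ, if_true, ← Finset.mul_sum] at h
  linarith

/-- In a minimal cone, every normal vector `X` satisfies
`∑ i j, ⟨B(e_i, e_j), X⟩² = (∑ i, d_i) |X|² / |x|²`. -/
theorem sum_inner_secondFundamentalForm_sq (hmin : IsMinimal (sphereCone d r))
    (hx : x ∈ sphereCone d r) {X : BlockSpace d} (hX : X ∈ (tangentSpace (sphereCone d r) x)ᗮ) :
    ∑ i, ∑ j, ⟪secondFundamentalForm (sphereCone d r) x (tangentFrame (sphereCone d r) x i)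
      (tangentFrame (sphereCone d r) x j), X⟫_ℝ ^ 2
      = (∑ i, (d i : ℝ)) * ‖X‖ ^ 2 * (‖x‖ ^ 2)⁻¹ := by
  have hn := (norm_pos_of_mem hr1 hx).ne'
  obtain ⟨c, rfl, hc⟩ := exists_eq_blockScale hr hr1 hx hX
  set P := tangential (sphereCone d r) x with hP
  -- The sum over `j` is `|P (c e_i)|²`, a quadratic form in `e_i`. Its radial term vanishes, since
  -- `c x` is normal; rotations are only scaled, by `c i`.
  have h := sum_tangentFrame hr hr1 hx ((innerₗ (BlockSpace d)).compl₁₂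
    (P ∘L blockScale c).toLinearMap (P ∘L blockScale c).toLinearMap)
  simp only [LinearMap.compl₁₂_apply, ContinuousLinearMap.coe_coe, innerₗ_apply_apply,
    ContinuousLinearMap.comp_apply, real_inner_self_eq_norm_sq] at h
  simp only [inner_secondFundamentalForm hr hr1 hx hc (SetLike.coe_mem _) (SetLike.coe_mem _),
    neg_sq, sum_inner_orthonormalBasis_sq]
  have hPX : P (blockScale c x) = 0 := (Submodule.starProjection_apply_eq_zero_iff _).2 hX
  have hPR (i : Fin l) (a b : Fin (d i + 1)) : P (blockRotation i a b x) = blockRotation i a b x :=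
    Submodule.starProjection_eq_self_iff.2 (blockRotation_mem_tangentSpace hr1 hx i a b)
  refine h.trans ?_
  simp only [hPX, blockScale_blockRotation, map_smul, hPR, norm_smul, mul_pow, ← Finset.mul_sum,
    sum_norm_blockRotation_sq, norm_block_sq hr1 hx, norm_blockScale_sq hr1 hx]
  -- Minimality turns the weights `d_i` into multiples of `r_i²`, so that `∑ d_i c_i²` becomes a
  -- multiple of `|X|² / |x|²`.
  have (i : Fin l) : (2 * r i ^ 2 * ‖x‖ ^ 2)⁻¹ *
      (‖c i‖ ^ 2 * (2 * (d i : ℝ) * (r i ^ 2 * ‖x‖ ^ 2))) = (∑ j, (d j : ℝ)) * (c i ^ 2 * r i ^ 2) := by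
    have hri := (hr i).ne'
    rw [Real.norm_eq_abs, sq_abs, dim_eq_of_isMinimal hr hr1 hmin i]
    field_simp
  simp only [this, ← Finset.mul_sum]
  field_simp
  simp

end

end Curvature

section Integration

/-! ### Integration over the cone -/

/-! ### Local parametrization of the cone -/

section Chart

variable {l : ℕ} {d : Fin l → ℕ}

/-- The domain of the central charts of the cone around the point `e`. -/
abbrev ChartSpace (e : BlockSpace d) : Type :=
  ℝ × ∀ i, (ℝ ∙ e i)ᗮ

theorem finrank_chartSpace {e : BlockSpace d} (he : ∀ i, e i ≠ 0) :
    Module.finrank ℝ (ChartSpace e) = (∑ i, d i) + 1 := by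
  have h (i : Fin l) : Module.finrank ℝ (ℝ ∙ e i)ᗮ = d i := by
    have : Fact (Module.finrank ℝ (EuclideanSpace ℝ (Fin (d i + 1))) = d i + 1) := ⟨by simp⟩
    exact Submodule.finrank_orthogonal_span_singleton (he i)
  rw [Module.finrank_prod, Module.finrank_pi_fintype, Module.finrank_self, add_comm]
  simp only [h]

/-- The inverse of the chart of the cone that projects every sphere centrally to a tangent
space. -/
def centralChart (r : Fin l → ℝ) (e : BlockSpace d) (p : ChartSpace e) : BlockSpace d :=
  WithLp.toLp 2 fun i => (p.1 * r i * ‖e i + (p.2 i : EuclideanSpace ℝ (Fin (d i + 1)))‖⁻¹) •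
    (e i + (p.2 i : EuclideanSpace ℝ (Fin (d i + 1))))

theorem contDiff_centralChart (r : Fin l → ℝ) {e : BlockSpace d} (he : ∀ i, e i ≠ 0) :
    ContDiff ℝ 1 (centralChart r e) := by
  refine contDiff_piLp' (p := 2) fun i => ?_
  have hlin : ContDiff ℝ 1 fun p : ChartSpace e =>
      e i + (p.2 i : EuclideanSpace ℝ (Fin (d i + 1))) := by
    refine contDiff_const.add ?_
    exact (((ℝ ∙ e i)ᗮ.subtypeL.comp (ContinuousLinearMap.proj i)).comp
      (ContinuousLinearMap.snd ℝ ℝ (∀ i, (ℝ ∙ e i)ᗮ))).contDiff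
  have hne (p : ChartSpace e) : e i + (p.2 i : EuclideanSpace ℝ (Fin (d i + 1))) ≠ 0 := by
    intro h
    have h1 := congrArg (fun v => ⟪e i, v⟫_ℝ) h
    simp only [inner_add_right, Submodule.mem_orthogonal_singleton_iff_inner_right.1 (p.2 i).2,
      add_zero, inner_zero_right, real_inner_self_eq_norm_sq] at h1
    exact he i (by simpa using h1)
  suffices hc : ContDiff ℝ 1 fun p : ChartSpace e => p.1 * r i *
      ‖e i + (p.2 i : EuclideanSpace ℝ (Fin (d i + 1)))‖⁻¹ from hc.smul hlin
  exact (contDiff_fst.mul contDiff_const).mul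
    ((hlin.norm ℝ hne).inv fun p => norm_ne_zero_iff.2 (hne p))

end Chart

variable {l : ℕ} {d : Fin l → ℕ} {r : Fin l → ℝ}

theorem isClosed_setOf_norm_block (d : Fin l → ℕ) (r : Fin l → ℝ) :
    IsClosed {x : BlockSpace d | ∀ i, ‖x i‖ = r i * ‖x‖} := by
  rw [Set.ofPred_forall]
  refine isClosed_iInter fun i => isClosed_eq ?_ ?_
  · exact (PiLp.continuous_apply 2 _ i).norm
  · fun_prop

theorem exists_annulus {E : Type*} [NormedAddCommGroup E] {K : Set E} (hK : IsCompact K)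
    (h0 : K ⊆ {0}ᶜ) :
    ∃ a b : ℝ, 0 < a ∧ ∀ y ∈ K, a ≤ ‖y‖ ∧ ‖y‖ ≤ b := by
  obtain ⟨b, hb⟩ := hK.isBounded.exists_norm_le
  have h1 : Kᶜ ∈ nhds (0 : E) := hK.isClosed.isOpen_compl.mem_nhds fun h => h0 h rfl
  obtain ⟨a, ha, hab⟩ := Metric.mem_nhds_iff.1 h1
  refine ⟨a, b, ha, fun y hy => ⟨?_, hb y hy⟩⟩
  by_contra! h
  exact hab (by simpa using h) hy

section

variable (hr : ∀ i, 0 < r i) (hr1 : ∑ i, r i ^ 2 = 1)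

include hr1

theorem sphereCone_eq : sphereCone d r = {0}ᶜ ∩ {x | ∀ i, ‖x i‖ = r i * ‖x‖} := by
  ext x
  rw [mem_sphereCone hr1]
  rfl

theorem measurableSet_sphereCone : MeasurableSet (sphereCone d r) := by
  rw [sphereCone_eq hr1]
  exact (measurableSet_singleton _).compl.inter (isClosed_setOf_norm_block d r).measurableSet

theorem isCompact_sphereCone_inter {K : Set (BlockSpace d)} (hK : IsCompact K) (h0 : K ⊆ {0}ᶜ) :
    IsCompact (sphereCone d r ∩ K) := by
  have : sphereCone d r ∩ K = K ∩ {x | ∀ i, ‖x i‖ = r i * ‖x‖} := by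
    rw [sphereCone_eq hr1]
    ext x
    exact ⟨fun h => ⟨h.2, h.1.2⟩, fun h => ⟨⟨h0 h.1, h.2⟩, h.1⟩⟩
  rw [this]
  exact hK.inter_right (isClosed_setOf_norm_block d r)

variable {k : ℕ} (hk : k = (∑ i, d i) + 1)

/-- The invariance of integrals over the cone under rotations of the blocks. -/
theorem setIntegral_comp_isometry (k : ℕ) {T : BlockSpace d ≃ₗᵢ[ℝ] BlockSpace d}
    (hT : ∀ x j, ‖T x j‖ = ‖x j‖) (φ : BlockSpace d → ℝ) :
    ∫ x in sphereCone d r, φ (T x) ∂μHE[k] = ∫ x in sphereCone d r, φ x ∂μHE[k] := by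
  have hpre : T ⁻¹' sphereCone d r = sphereCone d r := by
    ext x
    exact ⟨fun h => mem_sphereCone_of_norm_block hr1 h fun j => (hT x j).symm,
      fun h => mem_sphereCone_of_norm_block hr1 h (hT x)⟩
  have hmp : MeasurePreserving T μHE[k] μHE[k] :=
    T.toIsometryEquiv.measurePreserving_euclideanHausdorffMeasure k
  have := hmp.setIntegral_preimage_emb T.toHomeomorph.measurableEmbedding φ (sphereCone d r)
  rwa [hpre] at this

/-- The scaling of integrals over the cone under dilations. -/
theorem setIntegral_comp_smul (k : ℕ) {c : ℝ} (hc : 0 < c) (φ : BlockSpace d → ℝ) :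
    ∫ x in sphereCone d r, φ (c • x) ∂μHE[k]
      = (c⁻¹) ^ k * ∫ x in sphereCone d r, φ x ∂μHE[k] := by
  have hpre : (fun x => c • x) ⁻¹' sphereCone d r = sphereCone d r := by
    ext x
    refine ⟨fun h => ?_, fun h => smul_mem_sphereCone hr1 h hc⟩
    simpa [smul_smul, hc.ne'] using smul_mem_sphereCone hr1 h (inv_pos.2 hc)
  have hemb : MeasurableEmbedding fun x : BlockSpace d => c • x :=
    (Homeomorph.smulOfNeZero c hc.ne').measurableEmbedding
  have hmap : Measure.map (fun x : BlockSpace d => c • x) μHE[k]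
      = (‖c⁻¹‖₊ ^ k) • (μHE[k] : Measure (BlockSpace d)) := by
    ext s hs
    rw [hemb.map_apply, Set.preimage_smul₀ hc.ne',
      Measure.euclideanHausdorffMeasure_smul₀ k (inv_ne_zero hc.ne')]
    rfl
  have := hemb.setIntegral_map (μ := μHE[k]) φ (sphereCone d r)
  rw [hpre, hmap, Measure.restrict_smul, integral_smul_nnreal_measure] at this
  rw [← this, NNReal.smul_def, smul_eq_mul]
  simp [abs_of_pos hc]

include hr hk

/-- Near `e` the cone lies in the image of a ball in a `k`-dimensional space under a `C¹` map,
Lipschitz on that ball. Lipschitz maps keep Hausdorff measure finite. -/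
theorem finiteAtFilter_sphereCone {e : BlockSpace d} (he : e ∈ sphereCone d r) :
    (μHE[k] : Measure (BlockSpace d)).FiniteAtFilter (nhdsWithin e (sphereCone d r)) := by
  have hen (i : Fin l) : 0 < ‖e i‖ := by
    rw [((mem_sphereCone hr1).1 he).2 i]
    exact mul_pos (hr i) (norm_pos_of_mem hr1 he)
  have he0 (i : Fin l) : e i ≠ 0 := norm_pos_iff.1 (hen i)
  have hep := norm_pos_of_mem hr1 he
  -- Each `y i` makes an angle of cosine above 1/2 with `e i`, so its central projection has norm at
  -- most `2 |e_i|`. Subtracting `e i` leaves at most `3 |e|`.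
  let V : Set (BlockSpace d) :=
    {y | ‖y‖ < 3 * ‖e‖ ∧ ∀ i, ‖y i‖ * ‖e i‖ < 2 * ⟪e i, y i⟫_ℝ}
  have hV : IsOpen V := by
    have hVeq : V = {y | ‖y‖ < 3 * ‖e‖} ∩ ⋂ i, {y | ‖y i‖ * ‖e i‖ < 2 * ⟪e i, y i⟫_ℝ} := by
      ext y
      simp [V]
    rw [hVeq]
    refine (isOpen_lt continuous_norm continuous_const).inter ?_
    refine isOpen_iInter_of_finite fun i => ?_
    have hi : Continuous fun y : BlockSpace d => y i := PiLp.continuous_apply 2 _ i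
    exact isOpen_lt (hi.norm.mul continuous_const)
      (continuous_const.mul (continuous_const.inner hi))
  have heV : e ∈ V := by
    refine ⟨by linarith, fun i => ?_⟩
    rw [real_inner_self_eq_norm_sq]
    nlinarith [hen i, mul_pos (hen i) (hen i)]
  refine ⟨V ∩ sphereCone d r, ?_, ?_⟩
  · rw [Set.inter_comm]
    exact inter_mem_nhdsWithin _ (hV.mem_nhds heV)
  have hsub : V ∩ sphereCone d r ⊆ centralChart r e '' Metric.closedBall 0 (3 * ‖e‖) := by
    rintro y ⟨⟨hy1, hy2⟩, hyM⟩
    have hyn (i : Fin l) : ‖y i‖ = r i * ‖y‖ := ((mem_sphereCone hr1).1 hyM).2 i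
    have hyp := norm_pos_of_mem hr1 hyM
    have hypi (i : Fin l) : 0 < ‖y i‖ := by rw [hyn]; exact mul_pos (hr i) hyp
    have hin (i : Fin l) : 0 < ⟪e i, y i⟫_ℝ := by
      have := mul_pos (hypi i) (hen i)
      linarith [hy2 i]
    have hw (i : Fin l) : (‖e i‖ ^ 2 / ⟪e i, y i⟫_ℝ) • y i - e i ∈ (ℝ ∙ e i)ᗮ := by
      rw [Submodule.mem_orthogonal_singleton_iff_inner_right, inner_sub_right, inner_smul_right,
        real_inner_self_eq_norm_sq, div_mul_cancel₀ _ (hin i).ne', sub_self]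
    refine ⟨(‖y‖, fun i => ⟨_, hw i⟩), ?_, ?_⟩
    · have hR : (0 : ℝ) ≤ 3 * ‖e‖ := by positivity
      rw [mem_closedBall_zero_iff, Prod.norm_def, max_le_iff]
      refine ⟨by simpa using hy1.le, (pi_norm_le_iff_of_nonneg hR).2 fun i => ?_⟩
      rw [Submodule.coe_norm]
      refine (norm_sub_le _ _).trans ?_
      have h1 : ‖(‖e i‖ ^ 2 / ⟪e i, y i⟫_ℝ) • y i‖ ≤ 2 * ‖e i‖ := by
        rw [norm_smul, Real.norm_of_nonneg (div_nonneg (sq_nonneg _) (hin i).le),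
          div_mul_eq_mul_div, div_le_iff₀ (hin i)]
        nlinarith [hy2 i, hen i]
      linarith [PiLp.norm_apply_le e i]
    · ext i : 1
      have hc : 0 < ‖e i‖ ^ 2 / ⟪e i, y i⟫_ℝ := div_pos (pow_pos (hen i) 2) (hin i)
      simp only [centralChart, add_sub_cancel]
      rw [norm_smul, Real.norm_of_nonneg hc.le, hyn, smul_smul]
      convert one_smul ℝ (y i) using 2
      have hri := (hr i).ne'
      have h1 := (hin i).ne'
      have h2 := (hen i).ne'
      field_simp
  refine (measure_mono hsub).trans_lt ?_
  obtain ⟨L, hL⟩ := (contDiff_centralChart r he0).contDiffOn.exists_lipschitzOnWith one_ne_zero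
    (convex_closedBall 0 (3 * ‖e‖)) (isCompact_closedBall 0 (3 * ‖e‖))
  borelize (ChartSpace e)
  have hfin : μH[k] (Metric.closedBall (0 : ChartSpace e) (3 * ‖e‖)) < ⊤ := by
    rw [hk, ← finrank_chartSpace he0]
    have := isAddHaarMeasure_hausdorffMeasure (E := ChartSpace e)
    exact (isCompact_closedBall _ _).measure_lt_top
  have := hL.hausdorffMeasure_image_le (Nat.cast_nonneg k)
  rw [Measure.euclideanHausdorffMeasure_def, Measure.smul_apply]
  refine ENNReal.mul_lt_top ENNReal.coe_lt_top (this.trans_lt ?_)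
  exact ENNReal.mul_lt_top (ENNReal.rpow_lt_top_of_nonneg (Nat.cast_nonneg k) ENNReal.coe_ne_top)
    hfin

theorem measure_sphereCone_inter_lt_top {K : Set (BlockSpace d)} (hK : IsCompact K)
    (h0 : K ⊆ {0}ᶜ) : μHE[k] (sphereCone d r ∩ K) < ⊤ :=
  (isCompact_sphereCone_inter hr1 hK h0).measure_lt_top_of_nhdsWithin fun _ hx =>
    (finiteAtFilter_sphereCone hr hr1 hk hx.1).filter_mono
      (nhdsWithin_mono _ Set.inter_subset_left)

theorem integrableOn_sphereCone {g : BlockSpace d → ℝ} (hg : ContinuousOn g (sphereCone d r))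
    {K : Set (BlockSpace d)} (hK : IsCompact K) (h0 : K ⊆ {0}ᶜ)
    (hgK : ∀ x ∈ sphereCone d r, x ∉ K → g x = 0) :
    IntegrableOn g (sphereCone d r) μHE[k] := by
  have hfin := measure_sphereCone_inter_lt_top hr hr1 hk hK h0
  refine IntegrableOn.of_forall_sdiff_eq_zero (s := sphereCone d r ∩ K) ?_
    (measurableSet_sphereCone hr1) fun x hx => hgK x hx.1 fun h => hx.2 ⟨hx.1, h⟩
  have : IsFiniteMeasure (μHE[k].restrict (sphereCone d r ∩ K)) :=
    ⟨by rwa [Measure.restrict_apply_univ]⟩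
  have hint := (hg.mono Set.inter_subset_left).integrableOn_compact
    (isCompact_sphereCone_inter hr1 hK h0) (μ := μHE[k].restrict (sphereCone d r ∩ K))
  rwa [IntegrableOn, Measure.restrict_restrict
    (isCompact_sphereCone_inter hr1 hK h0).measurableSet, Set.inter_self] at hint

/-- Infinitesimal invariance: the integral over the cone of the derivative of a test function along
a flow that scales the area of the cone by `exp (c t)`. -/
theorem integral_fderiv_flow {B : BlockSpace d →L[ℝ] BlockSpace d}
    {T : ℝ → BlockSpace d → BlockSpace d} {σ c : ℝ} (hT0 : ∀ x, T 0 x = x)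
    (hT : ∀ t x, HasDerivAt (fun s => T s x) (B (T t x)) t)
    (hTn : ∀ t x, ‖T t x‖ = Real.exp (σ * t) * ‖x‖) (hTc : ∀ t, Continuous (T t))
    (hTi : ∀ t, ∀ φ : BlockSpace d → ℝ, ∫ x in sphereCone d r, φ (T t x) ∂μHE[k]
      = Real.exp (-c * t) * ∫ x in sphereCone d r, φ x ∂μHE[k])
    {φ : BlockSpace d → ℝ} (hφ : ContDiff ℝ 1 φ) (hφc : HasCompactSupport φ)
    (hφ0 : tsupport φ ⊆ {0}ᶜ) :
    ∫ x in sphereCone d r, fderiv ℝ φ x (B x) ∂μHE[k]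
      = -c * ∫ x in sphereCone d r, φ x ∂μHE[k] := by
  obtain ⟨a, b, ha, hab⟩ := exists_annulus hφc.isCompact hφ0
  have hdcont : Continuous fun y => fderiv ℝ φ y (B y) :=
    (hφ.continuous_fderiv one_ne_zero).clm_apply B.continuous
  have hdsupp (y : BlockSpace d) (hy : y ∉ tsupport φ) : fderiv ℝ φ y (B y) = 0 := by
    rw [fderiv_of_notMem_tsupport ℝ hy, zero_apply]
  obtain ⟨C, hC⟩ := (HasCompactSupport.intro hφc.isCompact hdsupp).exists_bound_of_continuous hdcont
  have hC0 : 0 ≤ C := (norm_nonneg _).trans (hC 0)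
  -- An annulus containing every point that the flow carries into the support of `φ` at a time `|t|
  -- < 1`; it supports the dominating function.
  let A : Set (BlockSpace d) :=
    {x | a * Real.exp (-|σ|) ≤ ‖x‖ ∧ ‖x‖ ≤ b * Real.exp |σ|}
  have hAc : IsClosed A := (isClosed_le continuous_const continuous_norm).inter
    (isClosed_le continuous_norm continuous_const)
  have hA : IsCompact A :=
    Metric.isCompact_of_isClosed_isBounded hAc
      (isBounded_iff_forall_norm_le.2 ⟨_, fun x hx => hx.2⟩)
  have hA0 : A ⊆ {0}ᶜ := by
    intro x hx h
    have := hx.1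
    rw [Set.mem_singleton_iff.1 h, norm_zero] at this
    have := mul_pos ha (Real.exp_pos (-|σ|))
    linarith
  have hTA (t : ℝ) (ht : t ∈ Metric.ball (0 : ℝ) 1) (x : BlockSpace d)
      (hx : T t x ∈ tsupport φ) : x ∈ A := by
    have ht1 : |σ * t| ≤ |σ| := by
      rw [abs_mul]
      have : |t| < 1 := by simpa using ht
      nlinarith [abs_nonneg σ]
    obtain ⟨h1, h2⟩ := hab _ hx
    rw [hTn] at h1 h2
    have hx' : ‖x‖ = Real.exp (-(σ * t)) * (Real.exp (σ * t) * ‖x‖) := by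
      rw [← mul_assoc, ← Real.exp_add]; simp
    constructor
    · rw [hx', mul_comm a]
      exact mul_le_mul (Real.exp_le_exp.2 (by linarith [le_abs_self (σ * t)])) h1 ha.le
        (Real.exp_pos _).le
    · rw [hx', mul_comm b]
      exact mul_le_mul (Real.exp_le_exp.2 (by linarith [neg_abs_le (σ * t)])) h2 (by positivity)
        (Real.exp_pos _).le
  have key := hasDerivAt_integral_of_dominated_loc_of_deriv_le
    (μ := μHE[k].restrict (sphereCone d r)) (F := fun t x => φ (T t x))
    (F' := fun t x => fderiv ℝ φ (T t x) (B (T t x))) (bound := A.indicator fun _ => C)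
    (x₀ := (0 : ℝ)) (Metric.ball_mem_nhds 0 one_pos)
    (Filter.Eventually.of_forall fun t => (hφ.continuous.comp (hTc t)).aestronglyMeasurable)
    ?_ ?_ ?_ ?_ ?_
  · have h1 := key.2
    -- The scaling law gives the same integral in closed form; its two derivatives at time 0 must
    -- agree.
    simp only [hTi, hT0] at h1
    have h2 : HasDerivAt (fun t => Real.exp (-c * t) * ∫ x in sphereCone d r, φ x ∂μHE[k])
        (-c * ∫ x in sphereCone d r, φ x ∂μHE[k]) 0 := by
      have := ((hasDerivAt_id (0 : ℝ)).const_mul (-c)).exp.mul_const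
        (∫ x in sphereCone d r, φ x ∂μHE[k])
      simpa using this
    exact h1.unique h2
  · simp only [hT0]
    exact integrableOn_sphereCone hr hr1 hk hφ.continuous.continuousOn hφc.isCompact hφ0
      fun x _ hx => image_eq_zero_of_notMem_tsupport hx
  · exact (hdcont.comp (hTc 0)).aestronglyMeasurable
  · refine Filter.Eventually.of_forall fun x t ht => ?_
    by_cases hx : T t x ∈ tsupport φ
    · rw [Set.indicator_of_mem (hTA t ht x hx)]
      exact hC _
    · rw [hdsupp _ hx, norm_zero]
      exact Set.indicator_nonneg (fun _ _ => hC0) x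
  · rw [integrable_indicator_iff hAc.measurableSet, IntegrableOn,
      Measure.restrict_restrict hAc.measurableSet, Set.inter_comm]
    exact integrableOn_const (measure_sphereCone_inter_lt_top hr hr1 hk hA hA0).ne
  · refine Filter.Eventually.of_forall fun x t _ => ?_
    exact ((hφ.differentiable one_ne_zero (T t x)).hasFDerivAt).comp_hasDerivAt t (hT t x)

theorem integral_fderiv_blockRotation (i : Fin l) (a b : Fin (d i + 1))
    {φ : BlockSpace d → ℝ} (hφ : ContDiff ℝ 1 φ) (hφc : HasCompactSupport φ)
    (hφ0 : tsupport φ ⊆ {0}ᶜ) :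
    ∫ x in sphereCone d r, fderiv ℝ φ x (blockRotation i a b x) ∂μHE[k] = 0 := by
  obtain ⟨T, hT0, hT, hTn⟩ := exists_blockRotation_flow i a b
  have := integral_fderiv_flow hr hr1 hk (T := fun t => T t) (σ := 0) (c := 0) hT0 hT (by simp)
    (fun t => (T t).continuous) (fun t φ => by
      simpa using setIntegral_comp_isometry hr1 k (hTn t) φ) hφ hφc hφ0
  simpa using this

theorem integral_fderiv_self {φ : BlockSpace d → ℝ} (hφ : ContDiff ℝ 1 φ)
    (hφc : HasCompactSupport φ) (hφ0 : tsupport φ ⊆ {0}ᶜ) :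
    ∫ x in sphereCone d r, fderiv ℝ φ x x ∂μHE[k]
      = -k * ∫ x in sphereCone d r, φ x ∂μHE[k] := by
  refine integral_fderiv_flow hr hr1 hk (T := fun t x => Real.exp t • x) (σ := 1) (c := k)
    (B := ContinuousLinearMap.id ℝ _) (by simp)
    (fun t x => (Real.hasDerivAt_exp t).smul_const x) (fun t x => by simp [norm_smul])
    (fun t => continuous_const_smul _) (fun t φ => ?_) hφ hφc hφ0
  rw [setIntegral_comp_smul hr1 k (Real.exp_pos t), ← Real.exp_neg, ← Real.exp_nat_mul]
  ring_nf

end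

end Integration

section Regularity

/-! ### Powers of the norm and test functions -/

theorem tsupport_subset_of_eq_zero {E F G : Type*} [TopologicalSpace E] [Zero F] [Zero G]
    {X : E → F} {φ : E → G} (h0 : ∀ x, X x = 0 → φ x = 0) : tsupport φ ⊆ tsupport X :=
  closure_mono fun x hx hX => hx (h0 x hX)

section NormRpow

variable {E : Type*} [NormedAddCommGroup E] [InnerProductSpace ℝ E]

theorem hasFDerivAt_norm_rpow_of_ne {x : E} (hx : x ≠ 0) (β : ℝ) :
    HasFDerivAt (fun y : E => ‖y‖ ^ β) ((β * ‖x‖ ^ (β - 2)) • innerSL ℝ x) x := by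
  have hn : 0 < ‖x‖ := norm_pos_iff.2 hx
  have h := (hasStrictFDerivAt_norm_sq x).hasFDerivAt.rpow_const (p := β / 2)
    (Or.inl (pow_pos hn 2).ne')
  have hpow (y : E) (γ : ℝ) : (‖y‖ ^ 2) ^ γ = ‖y‖ ^ (2 * γ) := by
    rw [← Real.rpow_natCast, ← Real.rpow_mul (norm_nonneg y)]
    norm_num
  simp only [hpow] at h
  convert h using 1
  · ext y; ring_nf
  · rw [show 2 * (β / 2 - 1) = β - 2 by ring]
    ext v
    simp
    ring

theorem contDiffAt_norm_rpow {x : E} (hx : x ≠ 0) (β : ℝ) {n : WithTop ℕ∞} :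
    ContDiffAt ℝ n (fun y : E => ‖y‖ ^ β) x :=
  (contDiffAt_norm ℝ hx).rpow_const_of_ne (norm_ne_zero_iff.2 hx)

theorem continuousOn_norm_rpow {s : Set E} (hs : s ⊆ {0}ᶜ) (β : ℝ) :
    ContinuousOn (fun y : E => ‖y‖ ^ β) s := fun _ hx =>
  (contDiffAt_norm_rpow (n := 0) (hs hx) β).continuousAt.continuousWithinAt

theorem fderiv_norm_rpow {x : E} (hx : x ≠ 0) (β : ℝ) (v : E) :
    fderiv ℝ (fun y : E => ‖y‖ ^ β) x v = β * ‖x‖ ^ (β - 2) * ⟪x, v⟫_ℝ := by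
  rw [(hasFDerivAt_norm_rpow_of_ne hx β).fderiv]
  simp

/-- The Hessian of `|x|^β` on vectors that are orthogonal to `x`. -/
theorem hessian_norm_rpow {x : E} (hx : x ≠ 0) (β : ℝ) {v : E} (hv : ⟪x, v⟫_ℝ = 0) :
    fderiv ℝ (fderiv ℝ fun y : E => ‖y‖ ^ β) x v v = β * (‖x‖ ^ (β - 2) * ‖v‖ ^ 2) := by
  have heq : (fderiv ℝ fun y : E => ‖y‖ ^ β)
      =ᶠ[nhds x] fun y => (β * ‖y‖ ^ (β - 2)) • innerSL ℝ y := by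
    filter_upwards [isOpen_ne.mem_nhds hx] with y hy
    exact (hasFDerivAt_norm_rpow_of_ne hy β).fderiv
  have h := ((hasFDerivAt_norm_rpow_of_ne hx (β - 2)).const_mul β).smul
    (innerSL ℝ (E := E)).hasFDerivAt
  have h' : HasFDerivAt (fun y => (β * ‖y‖ ^ (β - 2)) • innerSL ℝ y) _ x := h
  rw [heq.fderiv_eq, h'.fderiv]
  have hvv : innerSL ℝ v v = ‖v‖ ^ 2 := real_inner_self_eq_norm_sq v
  simp [hv, ← mul_assoc]
  exact Or.inl hvv

theorem rpow_mul_sq_inv {t : ℝ} (ht : 0 < t) (β : ℝ) : t ^ β * (t ^ 2)⁻¹ = t ^ (β - 2) := by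
  rw [Real.rpow_sub ht, Real.rpow_two, div_eq_mul_inv]

theorem rpow_sub_two_mul_sq {t : ℝ} (ht : 0 < t) (β : ℝ) : t ^ (β - 2) * t ^ 2 = t ^ β := by
  rw [← rpow_mul_sq_inv ht]
  field_simp

variable {X : E → E} {φ : E → ℝ}

/-- A power of the norm may be singular at the origin, but `X`, and hence `φ`, vanishes near it. -/
theorem IsVariationField.contDiff_of_eq_zero (hX : IsVariationField {0}ᶜ X)
    (hφ : ∀ x ≠ 0, ContDiffAt ℝ 1 φ x) (h0 : ∀ x, X x = 0 → φ x = 0) : ContDiff ℝ 1 φ := by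
  rw [contDiff_iff_contDiffAt]
  intro x
  by_cases hx : x = 0
  · have hmem : x ∉ tsupport φ := fun h =>
      hX.tsupport_subset (tsupport_subset_of_eq_zero h0 h) hx
    exact (contDiffAt_const (c := (0 : ℝ))).congr_of_eventuallyEq
      (notMem_tsupport_iff_eventuallyEq.1 hmem)
  · exact hφ x hx

theorem IsVariationField.hasCompactSupport_of_eq_zero (hX : IsVariationField {0}ᶜ X)
    (h0 : ∀ x, X x = 0 → φ x = 0) : HasCompactSupport φ :=
  hX.hasCompactSupport.of_isClosed_subset (isClosed_tsupport φ) (tsupport_subset_of_eq_zero h0)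

end NormRpow

variable {l : ℕ} {d : Fin l → ℕ} {r : Fin l → ℝ}

theorem sphereCone_subset : sphereCone d r ⊆ {0}ᶜ := fun _ h => h.2

section

variable (hr : ∀ i, 0 < r i) (hr1 : ∑ i, r i ^ 2 = 1)

include hr hr1

/-- Where no block vanishes, the cone is cut out by comparing every later block with block 0: `r_0²
|y_j|² = r_j² |y_0|²`. This gives codimension `l - 1`. -/
theorem isC2Submanifold_sphereCone {k : ℕ} (hk : k = (∑ i, d i) + 1) :
    IsC2Submanifold k (sphereCone d r) := by
  -- The case of no blocks contradicts `∑ r_i² = 1`.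
  obtain _ | m := l
  · simp at hr1
  have hfin : Module.finrank ℝ (BlockSpace d) = ∑ i, (d i + 1) := by
    rw [LinearEquiv.finrank_eq (WithLp.linearEquiv 2 ℝ _), Module.finrank_pi_fintype]
    simp
  refine ⟨m, by rw [hfin, hk, Finset.sum_add_distrib]; simp; ring, fun x hx => ?_⟩
  have happ (i : Fin (m + 1)) : Continuous fun y : BlockSpace d => y i :=
    PiLp.continuous_apply 2 _ i
  refine ⟨⋂ i, {y | y i ≠ 0}, isOpen_iInter_of_finite fun i =>
    isOpen_ne_fun (happ i) continuous_const, Set.mem_iInter.2 fun i => ?_,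
    fun y => WithLp.toLp 2 fun j => r 0 ^ 2 * ‖y j.succ‖ ^ 2 - r j.succ ^ 2 * ‖y 0‖ ^ 2,
    ?_, ?_, ?_⟩
  · have := ((mem_sphereCone hr1).1 hx).2 i
    refine norm_pos_iff.1 ?_
    rw [this]
    exact mul_pos (hr i) (norm_pos_of_mem hr1 hx)
  · refine ContDiff.contDiffOn (contDiff_piLp' (p := 2) fun j => ?_)
    have hb (i : Fin (m + 1)) : ContDiff ℝ 2 fun y : BlockSpace d => ‖y i‖ ^ 2 :=
      (contDiff_piLp_apply (p := 2) (i := i)).norm_sq ℝ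
    exact (contDiff_const.mul (hb _)).sub (contDiff_const.mul (hb _))
  · intro y hy z
    rw [Set.mem_iInter] at hy
    have hd (v : BlockSpace d) (j : Fin m) : fderiv ℝ (fun y : BlockSpace d =>
        (WithLp.toLp 2 fun j => r 0 ^ 2 * ‖y (Fin.succ j)‖ ^ 2 - r (Fin.succ j) ^ 2 * ‖y 0‖ ^ 2 :
          EuclideanSpace ℝ (Fin m))) y v j
        = r 0 ^ 2 * (2 * ⟪y j.succ, v j.succ⟫_ℝ) - r j.succ ^ 2 * (2 * ⟪y 0, v 0⟫_ℝ) := by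
      have hD (i : Fin (m + 1)) := (PiLp.hasFDerivAt_apply (𝕜 := ℝ) 2 y i).norm_sq
      have hF : HasFDerivAt (fun y : BlockSpace d =>
          (WithLp.toLp 2 fun j => r 0 ^ 2 * ‖y (Fin.succ j)‖ ^ 2 - r (Fin.succ j) ^ 2 * ‖y 0‖ ^ 2 :
            EuclideanSpace ℝ (Fin m))) ((PiLp.continuousLinearEquiv 2 ℝ
              fun _ : Fin m => ℝ).symm.toContinuousLinearMap ∘L ContinuousLinearMap.pi fun j =>
            (r 0 ^ 2 • (2 • (innerSL ℝ (y j.succ)).comp (PiLp.proj 2 _ j.succ))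
              - r j.succ ^ 2 • (2 • (innerSL ℝ (y 0)).comp (PiLp.proj 2 _ 0)))) y := by
        rw [← hasFDerivWithinAt_univ, hasFDerivWithinAt_piLp]
        intro j
        rw [hasFDerivWithinAt_univ]
        exact ((hD j.succ).const_mul _).sub ((hD 0).const_mul _)
      rw [hF.fderiv]
      simp
    -- Moving block `j + 1` radially affects only equation `j`, at rate `2 r_0² |y_{j+1}|²`.
    refine ⟨WithLp.toLp 2 (Fin.cons 0 fun j =>
      (z j / (2 * r 0 ^ 2 * ‖y j.succ‖ ^ 2)) • y j.succ), ?_⟩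
    ext j
    have h1 := norm_ne_zero_iff.2 (hy j.succ)
    have h2 := (hr 0).ne'
    rw [hd]
    simp only [Fin.cons_succ, Fin.cons_zero, inner_zero_right, inner_smul_right,
      real_inner_self_eq_norm_sq]
    field_simp
    ring
  · intro y hy
    rw [Set.mem_iInter] at hy
    constructor
    · intro hyM
      ext j
      simp only [norm_block_sq hr1 hyM, PiLp.zero_apply]
      ring
    · intro h
      have hb (i : Fin (m + 1)) : r 0 ^ 2 * ‖y i‖ ^ 2 = r i ^ 2 * ‖y 0‖ ^ 2 := by
        refine Fin.cases rfl (fun j => ?_) i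
        have := congrArg (fun w : EuclideanSpace ℝ (Fin m) => w j) h
        simpa [sub_eq_zero] using this
      have hs : r 0 ^ 2 * ‖y‖ ^ 2 = ‖y 0‖ ^ 2 := by
        rw [PiLp.norm_sq_eq_of_L2, Finset.mul_sum, Finset.sum_congr rfl fun i _ => hb i,
          ← Finset.sum_mul, hr1, one_mul]
      rw [mem_sphereCone hr1]
      refine ⟨fun h0 => hy 0 (by rw [h0]; rfl), fun i => ?_⟩
      rw [← sq_eq_sq₀ (norm_nonneg _) (mul_nonneg (hr i).le (norm_nonneg _))]
      refine mul_left_cancel₀ (pow_pos (hr 0) 2).ne' ?_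
      rw [hb, ← hs]
      ring

end

end Regularity

section Stability

/-! ### Stationarity and stability -/

section TestFunctions

variable {E : Type*} [NormedAddCommGroup E] [InnerProductSpace ℝ E] {X : E → E}

/-- The derivative of the test function `|x|^β ⟨X, A x⟩`. -/
theorem fderiv_norm_rpow_mul_inner (hX : Differentiable ℝ X) (A : E →L[ℝ] E) (β : ℝ) {x : E}
    (hx : x ≠ 0) (v : E) :
    fderiv ℝ (fun y => ‖y‖ ^ β * ⟪X y, A y⟫_ℝ) x v
      = β * ‖x‖ ^ (β - 2) * ⟪x, v⟫_ℝ * ⟪X x, A x⟫_ℝ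
        + ‖x‖ ^ β * (⟪fderiv ℝ X x v, A x⟫_ℝ + ⟪X x, A v⟫_ℝ) := by
  have h := (hasFDerivAt_norm_rpow_of_ne hx β).mul
    ((hX x).hasFDerivAt.inner ℝ (A.hasFDerivAt (x := x)))
  have h' : HasFDerivAt (fun y => ‖y‖ ^ β * ⟪X y, A y⟫_ℝ) _ x := h
  rw [h'.fderiv]
  simp [fderivInnerCLM_apply]
  ring

/-- The derivative of the test function `|x|^β |X|²`. -/
theorem fderiv_norm_rpow_mul_norm_sq (hX : Differentiable ℝ X) (β : ℝ) {x : E}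
    (hx : x ≠ 0) (v : E) :
    fderiv ℝ (fun y => ‖y‖ ^ β * ‖X y‖ ^ 2) x v
      = β * ‖x‖ ^ (β - 2) * ⟪x, v⟫_ℝ * ‖X x‖ ^ 2
        + ‖x‖ ^ β * (2 * ⟪X x, fderiv ℝ X x v⟫_ℝ) := by
  have h := (hasFDerivAt_norm_rpow_of_ne hx β).mul (hX x).hasFDerivAt.norm_sq
  have h' : HasFDerivAt (fun y => ‖y‖ ^ β * ‖X y‖ ^ 2) _ x := h
  rw [h'.fderiv]
  simp
  ring

theorem contDiffAt_norm_rpow_mul_inner (hX : ContDiff ℝ 1 X) (A : E →L[ℝ] E) (β : ℝ) (x : E)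
    (hx : x ≠ 0) : ContDiffAt ℝ 1 (fun y => ‖y‖ ^ β * ⟪X y, A y⟫_ℝ) x :=
  (contDiffAt_norm_rpow hx β).mul (hX.contDiffAt.inner ℝ A.contDiff.contDiffAt)

theorem contDiffAt_norm_rpow_mul_norm_sq (hX : ContDiff ℝ 1 X) (β : ℝ) (x : E) (hx : x ≠ 0) :
    ContDiffAt ℝ 1 (fun y => ‖y‖ ^ β * ‖X y‖ ^ 2) x :=
  (contDiffAt_norm_rpow hx β).mul (hX.contDiffAt.norm_sq ℝ)

end TestFunctions

variable {l : ℕ} {d : Fin l → ℕ} {r : Fin l → ℝ}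

section

variable (hr : ∀ i, 0 < r i) (hr1 : ∑ i, r i ^ 2 = 1) {k : ℕ} (hk : k = (∑ i, d i) + 1)

include hr hr1 hk

theorem integrableOn_testFunction {φ : BlockSpace d → ℝ} (hφ : Continuous φ)
    (hφc : HasCompactSupport φ) (hφ0 : tsupport φ ⊆ {0}ᶜ) :
    IntegrableOn φ (sphereCone d r) μHE[k] :=
  integrableOn_sphereCone hr hr1 hk hφ.continuousOn hφc.isCompact hφ0
    fun _ _ hx => image_eq_zero_of_notMem_tsupport hx

theorem integrableOn_fderiv {φ : BlockSpace d → ℝ} (hφ : ContDiff ℝ 1 φ)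
    (hφc : HasCompactSupport φ) (hφ0 : tsupport φ ⊆ {0}ᶜ) (B : BlockSpace d →L[ℝ] BlockSpace d) :
    IntegrableOn (fun x => fderiv ℝ φ x (B x)) (sphereCone d r) μHE[k] := by
  refine integrableOn_sphereCone hr hr1 hk
    ((hφ.continuous_fderiv one_ne_zero).clm_apply B.continuous).continuousOn hφc.isCompact hφ0
    fun x _ hx => ?_
  rw [fderiv_of_notMem_tsupport ℝ hx, zero_apply]

variable (hmin : IsMinimal (sphereCone d r)) (α : ℝ)

include hmin

/-- On a minimal cone the integrand of the first variation of `∫ |x|^α` is a sum of derivatives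
along rotations and of the divergence of a radial field. -/
theorem firstVariationIntegrand_eq {X : BlockSpace d → BlockSpace d} (hX : Differentiable ℝ X)
    {x : BlockSpace d} (hx : x ∈ sphereCone d r) :
    firstVariationIntegrand (fun y => ‖y‖ ^ α) (sphereCone d r) X x
      = fderiv ℝ (fun y => ‖y‖ ^ (α - 2) * ⟪X y, y⟫_ℝ) x x + k * (‖x‖ ^ (α - 2) * ⟪X x, x⟫_ℝ)
        + ∑ i, (2 * r i ^ 2)⁻¹ * ∑ a, ∑ b,
          fderiv ℝ (fun y => ‖y‖ ^ (α - 2) * ⟪X y, blockRotation i a b y⟫_ℝ) x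
            (blockRotation i a b x) := by
  have hx0 : x ≠ 0 := hx.2
  have hn := norm_pos_of_mem hr1 hx
  have hdiv := sum_tangentFrame hr hr1 hx
    ((innerₗ (BlockSpace d)) ∘ₗ (fderiv ℝ X x).toLinearMap)
  simp only [LinearMap.comp_apply, ContinuousLinearMap.coe_coe, innerₗ_apply_apply] at hdiv
  have hrad := fderiv_norm_rpow_mul_inner hX (ContinuousLinearMap.id ℝ _) (α - 2) hx0 x
  simp only [ContinuousLinearMap.id_apply, real_inner_self_eq_norm_sq] at hrad
  have hrot (i : Fin l) : ∑ a, ∑ b,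
      fderiv ℝ (fun y => ‖y‖ ^ (α - 2) * ⟪X y, blockRotation i a b y⟫_ℝ) x
        (blockRotation i a b x) = ‖x‖ ^ (α - 2) * ((∑ a, ∑ b, ⟪fderiv ℝ X x (blockRotation i a b x),
          blockRotation i a b x⟫_ℝ) - 2 * d i * ⟪X x i, x i⟫_ℝ) := by
    have hRR : ∑ a, ∑ b, ⟪X x, blockRotation i a b (blockRotation i a b x)⟫_ℝ
        = -2 * d i * ⟪X x i, x i⟫_ℝ := by
      have h := congrArg (fun w => ⟪X x i, w⟫_ℝ) (sum_coordRotation_coordRotation (x i))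
      simp only [inner_sum, inner_smul_right] at h
      rw [show (-2 * d i : ℝ) = -2 * (((d i + 1 : ℕ) : ℝ) - 1) by push_cast; ring, ← h]
      refine Finset.sum_congr rfl fun a _ => Finset.sum_congr rfl fun b _ => ?_
      rw [real_inner_comm, inner_blockRotation, real_inner_comm, blockRotation_apply,
        PiLp.single_eq_same]
    simp only [fderiv_norm_rpow_mul_inner hX _ (α - 2) hx0, inner_blockRotation_self, mul_zero,
      zero_mul, zero_add, ← Finset.mul_sum, Finset.sum_add_distrib, hRR]
    ring
  have hsum : ∑ i, (2 * r i ^ 2)⁻¹ * (‖x‖ ^ (α - 2) *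
      ((∑ a, ∑ b, ⟪fderiv ℝ X x (blockRotation i a b x), blockRotation i a b x⟫_ℝ)
        - 2 * d i * ⟪X x i, x i⟫_ℝ))
      = ‖x‖ ^ α * (∑ i, (2 * r i ^ 2 * ‖x‖ ^ 2)⁻¹ * ∑ a, ∑ b,
        ⟪fderiv ℝ X x (blockRotation i a b x), blockRotation i a b x⟫_ℝ)
        -- By minimality `d_i / r_i² = k - 1` in all blocks, so the Casimir terms combine to a
        -- multiple of `⟨X, x⟩`.
        - (k - 1) * (‖x‖ ^ (α - 2) * ⟪X x, x⟫_ℝ) := by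
    have hk1 : (k : ℝ) - 1 = ∑ i, (d i : ℝ) := by rw [hk]; push_cast; ring
    rw [PiLp.inner_apply, hk1, Finset.mul_sum, Finset.mul_sum, Finset.mul_sum,
      ← Finset.sum_sub_distrib]
    refine Finset.sum_congr rfl fun i _ => ?_
    have hri := (hr i).ne'
    rw [dim_eq_of_isMinimal hr hr1 hmin i, ← rpow_sub_two_mul_sq hn α]
    field_simp
  simp only [firstVariationIntegrand, divergence]
  simp only [hrot]
  rw [hdiv, fderiv_norm_rpow hx0, hrad, hsum]
  linear_combination ⟪fderiv ℝ X x x, x⟫_ℝ * rpow_mul_sq_inv hn α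
    - (α - 2) * ⟪X x, x⟫_ℝ * rpow_sub_two_mul_sq hn (α - 2)
    + α * ‖x‖ ^ (α - 2) * real_inner_comm (X x) x

theorem isStationary_sphereCone :
    IsStationary k (fun x : BlockSpace d => ‖x‖ ^ α) (sphereCone d r) {0}ᶜ := by
  intro X hX
  have hXd : Differentiable ℝ X := hX.contDiff.differentiable one_ne_zero
  have htest (A : BlockSpace d →L[ℝ] BlockSpace d) (x : BlockSpace d) (hx : X x = 0) :
      ‖x‖ ^ (α - 2) * ⟪X x, A x⟫_ℝ = 0 := by rw [hx, inner_zero_left, mul_zero]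
  have hφ (A : BlockSpace d →L[ℝ] BlockSpace d) := hX.contDiff_of_eq_zero
    (contDiffAt_norm_rpow_mul_inner hX.contDiff A (α - 2)) (htest A)
  have hφc (A : BlockSpace d →L[ℝ] BlockSpace d) := hX.hasCompactSupport_of_eq_zero (htest A)
  have hφ0 (A : BlockSpace d →L[ℝ] BlockSpace d) :=
    (tsupport_subset_of_eq_zero (htest A)).trans hX.tsupport_subset
  have hint {φ : BlockSpace d → ℝ} := integrableOn_fderiv hr hr1 hk (φ := φ)
  have hM := measurableSet_sphereCone (d := d) hr1
  have hi1 : IntegrableOn (fun x => fderiv ℝ (fun y => ‖y‖ ^ (α - 2) * ⟪X y, y⟫_ℝ) x x)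
      (sphereCone d r) μHE[k] := hint (hφ (.id ℝ _)) (hφc _) (hφ0 _) (.id ℝ _)
  have hi2 : IntegrableOn (fun x => k * (‖x‖ ^ (α - 2) * ⟪X x, x⟫_ℝ)) (sphereCone d r) μHE[k] :=
    (integrableOn_testFunction hr hr1 hk (hφ (.id ℝ _)).continuous (hφc _)
      (hφ0 _)).const_mul (k : ℝ)
  have hi12 : IntegrableOn (fun x => fderiv ℝ (fun y => ‖y‖ ^ (α - 2) * ⟪X y, y⟫_ℝ) x x
      + k * (‖x‖ ^ (α - 2) * ⟪X x, x⟫_ℝ)) (sphereCone d r) μHE[k] := hi1.add hi2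
  have hi3 (i : Fin l) (a b : Fin (d i + 1)) :=
    hint (hφ (blockRotation i a b)) (hφc _) (hφ0 _) (blockRotation i a b)
  have hi4 (i : Fin l) : IntegrableOn (fun x => (2 * r i ^ 2)⁻¹ * ∑ a, ∑ b,
      fderiv ℝ (fun y => ‖y‖ ^ (α - 2) * ⟪X y, blockRotation i a b y⟫_ℝ) x
        (blockRotation i a b x)) (sphereCone d r) μHE[k] :=
    (integrable_finsetSum _ fun a _ => integrable_finsetSum _ fun b _ => hi3 i a b).const_mul _
  have heq : Set.EqOn (firstVariationIntegrand (fun y => ‖y‖ ^ α) (sphereCone d r) X) _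
      (sphereCone d r) := fun x hx =>
    firstVariationIntegrand_eq hr hr1 hk hmin α hXd hx
  refine ⟨IntegrableOn.congr_fun (hi12.add (integrable_finsetSum _ fun i _ => hi4 i))
    heq.symm hM, ?_⟩
  rw [setIntegral_congr_fun hM heq, integral_add hi12
    (integrable_finsetSum _ fun i _ => hi4 i), integral_add hi1 hi2, integral_const_mul,
    integral_finsetSum _ fun i _ => hi4 i]
  have h1 := integral_fderiv_self hr hr1 hk (hφ (.id ℝ _)) (hφc _) (hφ0 _)
  have h2 (i : Fin l) : ∫ x in sphereCone d r, (2 * r i ^ 2)⁻¹ * ∑ a, ∑ b,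
      fderiv ℝ (fun y => ‖y‖ ^ (α - 2) * ⟪X y, blockRotation i a b y⟫_ℝ) x
        (blockRotation i a b x) ∂μHE[k] = 0 := by
    rw [integral_const_mul, integral_finsetSum _ fun a _ =>
      integrable_finsetSum _ fun b _ => hi3 i a b]
    simp only [integral_finsetSum _ fun b _ => hi3 i _ b,
      integral_fderiv_blockRotation hr hr1 hk i _ _ (hφ (blockRotation i _ _)) (hφc _) (hφ0 _),
      Finset.sum_const_zero, mul_zero]
  simp only [h2, Finset.sum_const_zero, add_zero]
  simp only [ContinuousLinearMap.id_apply] at h1 ⊢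
  rw [h1]
  ring

omit hk in
theorem curvatureIntegrand_eq (f : BlockSpace d → ℝ) {X : BlockSpace d → BlockSpace d}
    {x : BlockSpace d} (hx : x ∈ sphereCone d r)
    (hX : X x ∈ (tangentSpace (sphereCone d r) x)ᗮ) :
    curvatureIntegrand f (sphereCone d r) X x
      = f x * ((∑ i, (d i : ℝ)) * ‖X x‖ ^ 2 * (‖x‖ ^ 2)⁻¹) := by
  rw [curvatureIntegrand, sum_inner_secondFundamentalForm_sq hr hr1 hmin hx hX, hmin x hx]
  simp

end

section

variable (hr : ∀ i, 0 < r i) (hr1 : ∑ i, r i ^ 2 = 1)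

include hr hr1

theorem sum_norm_normal_sq {x : BlockSpace d} (hx : x ∈ sphereCone d r)
    (L : BlockSpace d →L[ℝ] BlockSpace d) :
    ∑ i, ‖normal (sphereCone d r) x (L (tangentFrame (sphereCone d r) x i))‖ ^ 2
      = (‖x‖ ^ 2)⁻¹ * ‖normal (sphereCone d r) x (L x)‖ ^ 2
        + ∑ i, (2 * r i ^ 2 * ‖x‖ ^ 2)⁻¹ *
          ∑ a, ∑ b, ‖normal (sphereCone d r) x (L (blockRotation i a b x))‖ ^ 2 := by
  have h := sum_tangentFrame hr hr1 hx ((innerₗ (BlockSpace d)).compl₁₂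
    (normal (sphereCone d r) x ∘L L).toLinearMap (normal (sphereCone d r) x ∘L L).toLinearMap)
  simpa only [LinearMap.compl₁₂_apply, ContinuousLinearMap.coe_coe, innerₗ_apply_apply,
    ContinuousLinearMap.comp_apply, real_inner_self_eq_norm_sq] using h

theorem continuousOn_normal {w : BlockSpace d → BlockSpace d}
    (hw : ContinuousOn w (sphereCone d r)) :
    ContinuousOn (fun y => normal (sphereCone d r) y (w y)) (sphereCone d r) := by
  refine (hw.sub (continuousOn_tangential hr hr1 hw)).congr fun y _ => ?_
  simp [normal, tangential, Submodule.starProjection_orthogonal_val]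

variable (α : ℝ) {X : BlockSpace d → BlockSpace d}

/-- The orthonormal frame is chosen separately at each point; this frame-free form shows that the
integrand is continuous on the cone. -/
theorem gradientIntegrand_eq {x : BlockSpace d} (hx : x ∈ sphereCone d r)
    (hX : X x ∈ (tangentSpace (sphereCone d r) x)ᗮ) :
    gradientIntegrand (fun y => ‖y‖ ^ α) (sphereCone d r) X x
      = ‖x‖ ^ α * ((‖x‖ ^ 2)⁻¹ * ‖normal (sphereCone d r) x (fderiv ℝ X x x)‖ ^ 2
        + ∑ i, (2 * r i ^ 2 * ‖x‖ ^ 2)⁻¹ *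
          ∑ a, ∑ b, ‖normal (sphereCone d r) x (fderiv ℝ X x (blockRotation i a b x))‖ ^ 2)
        + α * (‖x‖ ^ (α - 2) * ‖X x‖ ^ 2) := by
  rw [gradientIntegrand, sum_norm_normal_sq hr hr1 hx,
    hessian_norm_rpow hx.2 α (inner_self_normal hr1 hx hX)]

/-- Pointwise Hardy inequality: expand `0 ≤ |(D_x X)^⊥ + c X|²` and discard the rotational
derivatives. As `X` is normal, the cross term `2 c ⟨X, D_x X⟩` is part of the derivative of
`|x|^(α-2) |X|²`. -/
theorem le_gradientIntegrand (hXd : Differentiable ℝ X) {x : BlockSpace d}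
    (hx : x ∈ sphereCone d r) (hX : X x ∈ (tangentSpace (sphereCone d r) x)ᗮ) (c : ℝ) :
    -c * fderiv ℝ (fun y => ‖y‖ ^ (α - 2) * ‖X y‖ ^ 2) x x
        + (c * (α - 2) - c ^ 2 + α) * (‖x‖ ^ (α - 2) * ‖X x‖ ^ 2)
      ≤ gradientIntegrand (fun y => ‖y‖ ^ α) (sphereCone d r) X x := by
  have hn := norm_pos_of_mem hr1 hx
  have hXx : ⟪X x, normal (sphereCone d r) x (fderiv ℝ X x x)⟫_ℝ = ⟪X x, fderiv ℝ X x x⟫_ℝ := by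
    rw [normal, ← Submodule.inner_starProjection_left_eq_right,
      Submodule.starProjection_eq_self_iff.2 hX]
  have hsq : 0 ≤ ‖normal (sphereCone d r) x (fderiv ℝ X x x) + c • X x‖ ^ 2 := sq_nonneg _
  rw [norm_add_sq_real, inner_smul_right, real_inner_comm, hXx, norm_smul, mul_pow,
    Real.norm_eq_abs, sq_abs] at hsq
  have hrest : 0 ≤ ∑ i, (2 * r i ^ 2 * ‖x‖ ^ 2)⁻¹ * ∑ a, ∑ b,
      ‖normal (sphereCone d r) x (fderiv ℝ X x (blockRotation i a b x))‖ ^ 2 :=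
    Finset.sum_nonneg fun i _ => mul_nonneg (by positivity)
      (Finset.sum_nonneg fun a _ => Finset.sum_nonneg fun b _ => sq_nonneg _)
  have hpow : 0 ≤ ‖x‖ ^ (α - 2) := Real.rpow_nonneg (norm_nonneg x) _
  have hpow' : 0 ≤ ‖x‖ ^ α := Real.rpow_nonneg (norm_nonneg x) _
  rw [gradientIntegrand_eq hr hr1 α hx hX, mul_add, ← mul_assoc (‖x‖ ^ α),
    rpow_mul_sq_inv hn, fderiv_norm_rpow_mul_norm_sq hXd (α - 2) hx.2, real_inner_self_eq_norm_sq,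
    mul_assoc (α - 2), rpow_sub_two_mul_sq hn]
  linarith [mul_nonneg hpow' hrest, mul_nonneg hpow hsq]

theorem integrableOn_gradientIntegrand {k : ℕ} (hk : k = (∑ i, d i) + 1)
    (hX : IsVariationField {0}ᶜ X)
    (hXn : ∀ x ∈ sphereCone d r, X x ∈ (tangentSpace (sphereCone d r) x)ᗮ) :
    IntegrableOn (gradientIntegrand (fun y => ‖y‖ ^ α) (sphereCone d r) X) (sphereCone d r)
      μHE[k] := by
  refine integrableOn_sphereCone hr hr1 hk (ContinuousOn.congr ?_
    fun x hx => gradientIntegrand_eq hr hr1 α hx (hXn x hx)) hX.hasCompactSupport.isCompact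
    hX.tsupport_subset fun x hx hxX => ?_
  · have hD (A : BlockSpace d →L[ℝ] BlockSpace d) : ContinuousOn (fun x =>
        ‖normal (sphereCone d r) x (fderiv ℝ X x (A x))‖ ^ 2) (sphereCone d r) :=
      ((continuousOn_normal hr hr1 ((hX.contDiff.continuous_fderiv one_ne_zero).clm_apply
        A.continuous).continuousOn).norm).pow 2
    have hpow (β : ℝ) : ContinuousOn (fun x : BlockSpace d => ‖x‖ ^ β) (sphereCone d r) :=
      continuousOn_norm_rpow sphereCone_subset β
    have hsq (c : ℝ) (hc : c ≠ 0) : ContinuousOn (fun x : BlockSpace d => (c * ‖x‖ ^ 2)⁻¹)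
        (sphereCone d r) :=
      ContinuousOn.inv₀ (by fun_prop) fun x hx =>
        mul_ne_zero hc (pow_ne_zero 2 (norm_pos_of_mem hr1 hx).ne')
    refine ((hpow α).mul (ContinuousOn.add ?_ (continuousOn_finsetSum _ fun i _ =>
      (hsq _ ?_).mul (continuousOn_finsetSum _ fun a _ => continuousOn_finsetSum _ fun b _ =>
        hD (blockRotation i a b))))).add (continuousOn_const.mul ((hpow _).mul ?_))
    · exact ((hsq 1 one_ne_zero).mul (hD (.id ℝ _))).congr fun x _ => by simp
    · exact mul_ne_zero two_ne_zero (pow_ne_zero 2 (hr i).ne')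
    · exact (hX.contDiff.continuous.norm.pow 2).continuousOn
  · rw [gradientIntegrand, fderiv_of_notMem_tsupport ℝ hxX, image_eq_zero_of_notMem_tsupport hxX]
    simp

variable {k : ℕ} (hk : k = (∑ i, d i) + 1) (hmin : IsMinimal (sphereCone d r))

include hk hmin

/-- The stability inequality: on a minimal cone it follows from Hardy's inequality in the radial
direction. -/
theorem stability_inequality (hα : 0 ≤ ((α + k - 2) / 2) ^ 2 + α - (k - 1))
    (hX : IsVariationField {0}ᶜ X)
    (hXn : ∀ x ∈ sphereCone d r, X x ∈ (tangentSpace (sphereCone d r) x)ᗮ) :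
    IntegrableOn (curvatureIntegrand (fun y => ‖y‖ ^ α) (sphereCone d r) X) (sphereCone d r)
        μHE[k] ∧
      ∫ x in sphereCone d r, curvatureIntegrand (fun y => ‖y‖ ^ α) (sphereCone d r) X x ∂μHE[k]
        ≤ ∫ x in sphereCone d r,
          gradientIntegrand (fun y => ‖y‖ ^ α) (sphereCone d r) X x ∂μHE[k] := by
  have hM := measurableSet_sphereCone (d := d) hr1
  have hXd : Differentiable ℝ X := hX.contDiff.differentiable one_ne_zero
  have hk1 : (k : ℝ) - 1 = ∑ i, (d i : ℝ) := by rw [hk]; push_cast; ring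
  set ρ : BlockSpace d → ℝ := fun x => ‖x‖ ^ (α - 2) * ‖X x‖ ^ 2 with hρ
  -- After integration the coefficient of `∫ ρ` is `c (α + k - 2) - c² + α`; this `c` maximizes it.
  set c := (α + k - 2) / 2 with hc
  have h0 (x : BlockSpace d) (hx : X x = 0) : ρ x = 0 := by simp [hρ, hx]
  have hρ1 : ContDiff ℝ 1 ρ :=
    hX.contDiff_of_eq_zero (contDiffAt_norm_rpow_mul_norm_sq hX.contDiff (α - 2)) h0
  have hρc : HasCompactSupport ρ := hX.hasCompactSupport_of_eq_zero h0
  have hρ0 : tsupport ρ ⊆ {0}ᶜ := (tsupport_subset_of_eq_zero h0).trans hX.tsupport_subset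
  have hρi : IntegrableOn ρ (sphereCone d r) μHE[k] :=
    integrableOn_testFunction hr hr1 hk hρ1.continuous hρc hρ0
  have hDi : IntegrableOn (fun x => fderiv ℝ ρ x x) (sphereCone d r) μHE[k] :=
    integrableOn_fderiv hr hr1 hk hρ1 hρc hρ0 (.id ℝ _)
  have hDint := integral_fderiv_self hr hr1 hk hρ1 hρc hρ0
  have hcurv : Set.EqOn (curvatureIntegrand (fun y => ‖y‖ ^ α) (sphereCone d r) X)
      (fun x => ((k : ℝ) - 1) * ρ x) (sphereCone d r) := fun x hx => by
    rw [curvatureIntegrand_eq hr hr1 hmin _ hx (hXn x hx), hk1, hρ]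
    simp only [← rpow_mul_sq_inv (norm_pos_of_mem hr1 hx) α]
    ring
  refine ⟨IntegrableOn.congr_fun (f := fun x => ((k : ℝ) - 1) * ρ x) (hρi.const_mul _)
    hcurv.symm hM, ?_⟩
  have hlow : ∀ x ∈ sphereCone d r, -c * fderiv ℝ ρ x x + (c * (α - 2) - c ^ 2 + α) * ρ x
      ≤ gradientIntegrand (fun y => ‖y‖ ^ α) (sphereCone d r) X x :=
    fun x hx => le_gradientIntegrand hr hr1 α hXd hx (hXn x hx) c
  have hlowi : IntegrableOn (fun x => -c * fderiv ℝ ρ x x + (c * (α - 2) - c ^ 2 + α) * ρ x)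
      (sphereCone d r) μHE[k] := (hDi.const_mul _).add (hρi.const_mul _)
  have hle := setIntegral_mono_on hlowi
    (integrableOn_gradientIntegrand hr hr1 α hk hX hXn) hM hlow
  refine le_trans ?_ hle
  rw [setIntegral_congr_fun hM hcurv, integral_add (hDi.const_mul _) (hρi.const_mul _),
    integral_const_mul, integral_const_mul, integral_const_mul, hDint]
  have hρnn : 0 ≤ ∫ x in sphereCone d r, ρ x ∂μHE[k] :=
    integral_nonneg fun x => by positivity
  have h2c : α = 2 * c - k + 2 := by rw [hc]; ring
  rw [← sub_nonneg]
  convert mul_nonneg hα hρnn using 1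
  linear_combination c * (∫ x in sphereCone d r, ρ x ∂μHE[k]) * h2c

theorem isStable_sphereCone (hα : 0 ≤ ((α + k - 2) / 2) ^ 2 + α - (k - 1)) :
    IsStable k (fun x : BlockSpace d => ‖x‖ ^ α) (sphereCone d r) {0}ᶜ where
  isOpen := isOpen_compl_singleton
  nonempty := by
    obtain ⟨x, hx⟩ := sphereCone_nonempty (d := d) hr1 hr
    exact ⟨x, hx.2, hx⟩
  closed_in := by
    rw [Set.eq_empty_iff_forall_notMem]
    rintro x ⟨hx0, hxc, hx⟩
    have hsub : sphereCone d r ⊆ {x | ∀ i, ‖x i‖ = r i * ‖x‖} := by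
      rw [sphereCone_eq hr1]
      exact Set.inter_subset_right
    refine hx ((mem_sphereCone hr1).2 ⟨hx0, ?_⟩)
    exact closure_minimal hsub (isClosed_setOf_norm_block d r) hxc
  density := fun x hx => (contDiffAt_norm_rpow hx α).contDiffWithinAt
  submanifold := isC2Submanifold_sphereCone hr hr1 hk
  stationary := isStationary_sphereCone hr hr1 hk hmin α
  stability := fun _ hX hXn =>
    ⟨(stability_inequality hr hr1 α hk hmin hα hX hXn).1,
      integrableOn_gradientIntegrand hr hr1 α hk hX hXn,
      (stability_inequality hr hr1 α hk hmin hα hX hXn).2⟩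

end

/-- In terms of `s = α + k` the expression is `s² / 4 - 2 (k - 1)`. -/
theorem hardy_coefficient_nonneg {k α : ℝ} (hk : 1 ≤ k)
    (h : -k + 2 * Real.sqrt (2 * (k - 1)) ≤ α) : 0 ≤ ((α + k - 2) / 2) ^ 2 + α - (k - 1) := by
  have hs := Real.sq_sqrt (show 0 ≤ 2 * (k - 1) by linarith)
  have hs0 := Real.sqrt_nonneg (2 * (k - 1))
  nlinarith

/-- Equality holds at `k = 7`. After squaring, the bound on the root follows from `2 (k - 7) ≤ 2 √3
(k - 7)`. -/
theorem threshold_le {k : ℝ} (hk : 7 ≤ k) :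
    -k + 2 * Real.sqrt (2 * (k - 1)) ≤ 4 * Real.sqrt 3 - 7 := by
  have h3 := Real.sq_sqrt (show (0 : ℝ) ≤ 3 by norm_num)
  have h30 := Real.sqrt_nonneg 3
  have h1 : 1 ≤ Real.sqrt 3 := Real.one_le_sqrt.2 (by norm_num)
  have hle : Real.sqrt (2 * (k - 1)) ≤ (k - 7) / 2 + 2 * Real.sqrt 3 := by
    refine Real.sqrt_le_iff.2 ⟨by linarith, ?_⟩
    nlinarith [mul_nonneg (sub_nonneg.2 hk) (sub_nonneg.2 h1), sq_nonneg (k - 7)]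
  linarith

end Stability

end WeightedArea

end

theorem corollary1p7 {l : ℕ} (d : Fin l → ℕ) (r : Fin l → ℝ)
    (hr : ∀ i, 0 < r i) (hr1 : ∑ i, r i ^ 2 = 1)
    (k : ℕ) (hk : k = (∑ i, d i) + 1)
    (hmin : WeightedArea.IsMinimal
      (WeightedArea.cone (WeightedArea.sphereProduct d r) \ {0}))
    (α : ℝ) :
    (-(k : ℝ) + 2 * Real.sqrt (2 * ((k : ℝ) - 1)) ≤ α →
      WeightedArea.IsStable k (fun x : WeightedArea.BlockSpace d => ‖x‖ ^ α)
        (WeightedArea.cone (WeightedArea.sphereProduct d r) \ {0}) {0}ᶜ) ∧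
    (7 ≤ k → 4 * Real.sqrt 3 - 7 ≤ α →
      WeightedArea.IsStable k (fun x : WeightedArea.BlockSpace d => ‖x‖ ^ α)
        (WeightedArea.cone (WeightedArea.sphereProduct d r) \ {0}) {0}ᶜ) := by
  have hk1 : (1 : ℝ) ≤ k := by exact_mod_cast (show 1 ≤ k by omega)
  refine ⟨fun hα => ?_, fun hk7 hα => ?_⟩
  · exact WeightedArea.isStable_sphereCone hr hr1 α hk hmin
      (WeightedArea.hardy_coefficient_nonneg hk1 hα)
  · exact WeightedArea.isStable_sphereCone hr hr1 α hk hmin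
      (WeightedArea.hardy_coefficient_nonneg hk1
        ((WeightedArea.threshold_le (by exact_mod_cast hk7)).trans hα))
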